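/- A signature $\sigma$ is a finite set of symbols $f$, each with an arity $\mathrm{ar}(f)\in\mathbb{N}$. A $\sigma$-structure $\mathbb{A}$ consists of a finite non-empty domain $A$ and a function $f^{\mathbb{A}}\colon A^{\mathrm{ar}(f)}\to\mathbb{Q}_{\ge 0}$ for each $f\in\sigma$. Its Gaifman graph is the graph on $A$ in which distinct $u,v$ are adjacent if they appear together in some tuple $\mathbf{x}$ with $f^{\mathbb{A}}(\mathbf{x})>0$ for some $f\in\sigma$. For $\sigma$-structures $\mathbb{A},\mathbb{C}$ let $$\mathrm{opt}(\mathbb{A},\mathbb{C})=\max_{h\colon A\to C}\ \sum_{f\in\sigma}\ \sum_{\mathbf{x}\in A^{\mathrm{ar}(f)}} f^{\mathbb{A}}(\mathbf{x})\,f^{\mathbb{C}}(h(\mathbf{x})),$$ and for $\sigma$-structures $\mathbb{A},\mathbb{B}$ let $$d_{\mathrm{opt}}(\mathbb{A},\mathbb{B})=\sup_{\mathbb{C}}\bigl|\ln \mathrm{opt}(\mathbb{A},\mathbb{C})-\ln\mathrm{opt}(\mathbb{B},\mathbb{C})\bigr|\in[0,\infty],$$ where $\mathbb{C}$ ranges over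 all $\sigma$-structures, $\ln 0=-\infty$ and $|\ln 0-\ln 0|=0$. Let $p$ be a parameter of finite graphs with values in $\mathbb{N}$, and write $p(\mathbb{B})$ for the value of $p$ on the Gaifman graph of $\mathbb{B}$. A class $\mathcal{A}$ of structures (whose signatures may vary) is called $p$-pliable if for every real $\varepsilon>0$ there is a $k\in\mathbb{N}$ such that for every signature $\sigma$ and every $\sigma$-structure $\mathbb{A}\in\mathcal{A}$ there is a $\sigma$-structure $\mathbb{B}$ with $p(\mathbb{B})\le k$ and $d_{\mathrm{opt}}(\mathbb{A},\mathbb{B})\le\varepsilon$. The parameters considered are the treedepth; the treewidth; the Hadwiger number (the largest $k$ such that $K_k$ is a minor of the graph); the size (number of vertices); and the maximum component size (the largest number of vertices of a connected component). The class $\mathcal{A}$ has bounded signatures if there is an $N$ such that every signature $\sigma$ of a structure in $\mathcal{A}$ has at most $N$ symbols, each of arity at most $N$. **Theorem.** Let $\mathcal{A}$ be any class of structures. The following are equivalent: 1. $\mathcal{A}$ is treedepth-pliable; 2. $\mathcal{A}$ is treewidth-pliable; 3. $\mathcal{A}$ is Hadwiger-pliable. If moreover $\mathcal{A}$ has bounded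 signatures, then each of the following is also equivalent to 1, 2 and 3: 4. $\mathcal{A}$ is size-pliable; 5. $\mathcal{A}$ is maximum-component-size-pliable. -/

import Mathlib

namespace Pliability

/-! ### Graph parameters -/

section Graphs

variable {V W : Type}

/-- The vertices of `S` that lie in the same connected component as `v` in the subgraph of `G`
induced on `S` (empty if `v` is not in `S`). -/
def componentIn (G : SimpleGraph V) (S : Finset V) (v : V) : Set V :=
  {w | ∃ (hv : v ∈ S) (hw : w ∈ S),
    (G.induce (S : Set V)).Reachable ⟨v, hv⟩ ⟨w, hw⟩}

theorem componentIn_subset (G : SimpleGraph V) (S : Finset V) (v : V) :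
    componentIn G S v ⊆ S := by
  rintro w ⟨_, hw, _⟩
  exact hw

open Classical in
theorem filter_componentIn_card_lt (G : SimpleGraph V) (S : Finset V) (v : V) (hv : v ∈ S)
    (hS : ¬ (G.induce (S : Set V)).Connected) :
    (S.filter (· ∈ componentIn G S v)).card < S.card := by
  apply Finset.card_lt_card
  refine (Finset.filter_subset _ _).ssubset_of_ne fun h => hS ?_
  have key : ∀ x : (S : Set V), (G.induce (S : Set V)).Reachable ⟨v, hv⟩ x := by
    rintro ⟨w, hw⟩
    have hw' : w ∈ S.filter (· ∈ componentIn G S v) := by rw [h]; exact hw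
    obtain ⟨_, _, hr⟩ := (Finset.mem_filter.1 hw').2
    exact hr
  have : Nonempty (S : Set V) := ⟨⟨v, hv⟩⟩
  exact ⟨fun x y => (key x).symm.trans (key y)⟩

open Classical in
/-- The treedepth of the subgraph of `G` induced on `S`, by the usual recursion: a single vertex
has treedepth `1`; a connected graph with more than one vertex has treedepth
`1 + min_v td (G - v)`; a disconnected graph has the maximum of the treedepths of its components.
(The empty graph gets the value `0`.) -/
noncomputable def treedepthOn (G : SimpleGraph V) (S : Finset V) : ℕ :=
  if hne : S.Nonempty then
    if hc : (G.induce (S : Set V)).Connected then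
      if S.card = 1 then 1
      else S.attach.inf' (by simpa using hne) (fun v => treedepthOn G (S.erase v.1)) + 1
    else S.attach.sup (fun v => treedepthOn G (S.filter (· ∈ componentIn G S v.1)))
  else 0
termination_by S.card
decreasing_by
  · exact Finset.card_erase_lt_of_mem v.2
  · exact filter_componentIn_card_lt G S v.1 v.2 hc

/-- Treedepth of a finite graph. -/
noncomputable def treedepth (V : Type) [Fintype V] (G : SimpleGraph V) : ℕ :=
  treedepthOn G Finset.univ

/-- A tree decomposition of `G`, indexed by the nodes of a finite tree. -/
structure TreeDecomposition (G : SimpleGraph V) where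
  /-- The nodes of the tree. -/
  Node : Type
  [fintypeNode : Fintype Node]
  /-- The tree. -/
  tree : SimpleGraph Node
  isTree : tree.IsTree
  /-- The bags. -/
  bag : Node → Finset V
  exists_mem_bag : ∀ v : V, ∃ t, v ∈ bag t
  exists_edge_bag : ∀ u v : V, G.Adj u v → ∃ t, u ∈ bag t ∧ v ∈ bag t
  /-- If `s` lies on the path of the tree from `t` to `t'`, a vertex in both end bags is in the
  bag of `s`. -/
  mem_bag_of_mem_path : ∀ (t t' : Node) (p : tree.Walk t t'), p.IsPath → ∀ s ∈ p.support,
    ∀ v : V, v ∈ bag t → v ∈ bag t' → v ∈ bag s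

attribute [instance] TreeDecomposition.fintypeNode

/-- The width: the largest size of a bag, minus one. (Some bag is non-empty as soon as the graph
has a vertex, so that the subtraction does not truncate.) -/
def TreeDecomposition.width {G : SimpleGraph V} (D : TreeDecomposition G) : ℕ :=
  (Finset.univ.sup fun t => (D.bag t).card) - 1

/-- Treewidth of a finite graph: the minimum width of a tree decomposition. -/
noncomputable def treewidth (V : Type) [Fintype V] (G : SimpleGraph V) : ℕ :=
  sInf {w | ∃ D : TreeDecomposition G, D.width = w}

/-- `H` is a minor of `G`: there are pairwise disjoint connected (in particular non-empty) branch
sets in `G`, one for each vertex of `H`, with an edge of `G` between the branch sets of any two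
adjacent vertices of `H`. -/
def IsMinor (H : SimpleGraph W) (G : SimpleGraph V) : Prop :=
  ∃ branch : W → Set V,
    (∀ x, (G.induce (branch x)).Connected) ∧
    (∀ x y, x ≠ y → Disjoint (branch x) (branch y)) ∧
    (∀ x y, H.Adj x y → ∃ u ∈ branch x, ∃ v ∈ branch y, G.Adj u v)

/-- Hadwiger number of a finite graph: the largest `k` such that the complete graph on `k` vertices
is a minor. -/
noncomputable def hadwiger (V : Type) [Fintype V] (G : SimpleGraph V) : ℕ :=
  sSup {k | IsMinor (⊤ : SimpleGraph (Fin k)) G}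

/-- Number of vertices. -/
def size (V : Type) [Fintype V] (_G : SimpleGraph V) : ℕ := Fintype.card V

/-- Maximum number of vertices of a connected component. -/
noncomputable def maxComponentSize (V : Type) [Fintype V] (G : SimpleGraph V) : ℕ :=
  ⨆ c : G.ConnectedComponent, c.supp.ncard

/-- A parameter of finite graphs with values in the natural numbers. -/
abbrev GraphParameter := ∀ (V : Type) [Fintype V], SimpleGraph V → ℕ

end Graphs

/-! ### Valued structures -/

/-- A signature: finitely many symbols, each with an arity. -/
structure Signature where
  /-- The symbols. -/
  Symb : Type
  [fintypeSymb : Fintype Symb]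
  /-- The arity of a symbol. -/
  arity : Symb → ℕ

attribute [instance] Signature.fintypeSymb

/-- A valued structure: a finite non-empty domain and, for each symbol, a function from tuples to
non-negative rationals. -/
structure ValuedStructure (σ : Signature) where
  /-- The domain. -/
  Dom : Type
  [fintypeDom : Fintype Dom]
  [nonemptyDom : Nonempty Dom]
  /-- The value of a tuple under a symbol. -/
  val : (f : σ.Symb) → (Fin (σ.arity f) → Dom) → ℚ≥0

attribute [instance] ValuedStructure.fintypeDom ValuedStructure.nonemptyDom

variable {σ : Signature}

/-- The Gaifman graph: two distinct elements are adjacent if they appear together in a tuple of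
positive value. -/
def gaifman (A : ValuedStructure σ) : SimpleGraph A.Dom where
  Adj u v := u ≠ v ∧ ∃ (f : σ.Symb) (x : Fin (σ.arity f) → A.Dom),
    0 < A.val f x ∧ u ∈ Set.range x ∧ v ∈ Set.range x
  symm := ⟨fun _ _ ⟨h, f, x, hx, hu, hv⟩ => ⟨h.symm, f, x, hx, hv, hu⟩⟩
  loopless := ⟨fun _ h => h.1 rfl⟩

/-- The value of a map between the domains of two structures. -/
def mapVal (A B : ValuedStructure σ) (h : A.Dom → B.Dom) : ℚ≥0 :=
  ∑ f : σ.Symb, ∑ x : Fin (σ.arity f) → A.Dom, A.val f x * B.val f (h ∘ x)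

open Classical in
/-- `opt A B` is the maximum value of a map from the domain of `A` to the domain of `B`. -/
noncomputable def opt (A B : ValuedStructure σ) : ℚ≥0 :=
  (Finset.univ : Finset (A.Dom → B.Dom)).sup' Finset.univ_nonempty (mapVal A B)

/-- `|ln a - ln b|` in `[0, ∞]`, with `ln 0 = -∞` and `|ln 0 - ln 0| = 0`. -/
noncomputable def logDist (a b : ℚ≥0) : ENNReal :=
  if a = 0 ∧ b = 0 then 0
  else if a = 0 ∨ b = 0 then ⊤
  else ENNReal.ofReal |Real.log (a : ℝ) - Real.log (b : ℝ)|

/-- The opt-distance, a value in `[0, ∞]`. -/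
noncomputable def optDist (A B : ValuedStructure σ) : ENNReal :=
  ⨆ C : ValuedStructure σ, logDist (opt A C) (opt B C)

/-- A class of structures, over arbitrary and possibly varying signatures. -/
abbrev StructureClass := ∀ σ : Signature, Set (ValuedStructure σ)

/-- `𝒜` is pliable with respect to the parameter `p` (of Gaifman graphs). -/
def IsPliable (p : GraphParameter) (𝒜 : StructureClass) : Prop :=
  ∀ ε : ℝ, 0 < ε → ∃ k : ℕ, ∀ (σ : Signature), ∀ A ∈ 𝒜 σ,
    ∃ B : ValuedStructure σ, p B.Dom (gaifman B) ≤ k ∧ optDist A B ≤ ENNReal.ofReal ε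

/-- The structures in `𝒜` have bounded signatures: the number of symbols and their arities are
bounded by a constant. -/
def HasBoundedSignatures (𝒜 : StructureClass) : Prop :=
  ∃ N : ℕ, ∀ σ : Signature, (𝒜 σ).Nonempty →
    Fintype.card σ.Symb ≤ N ∧ ∀ f : σ.Symb, σ.arity f ≤ N

end Pliability

/-!
The equivalences follow from two cycles of implications. Four implications compare the parameters
of one graph: the treewidth is at most the treedepth (`treewidth_le_treedepth`, by a path
decomposition read off an elimination), the Hadwiger number is at most the treewidth plus one
(`hadwiger_le_treewidth`, by the Helly property of subtrees), and the treedepth is at most the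
maximum component size, which is at most the size. The two other implications replace a structure
by one at small opt-distance.

*From the Hadwiger number to the treedepth.* Let `G` have no complete minor on `k + 1` vertices.
Then `G` splits into connected pieces, each cut out of a component of what the earlier pieces leave
and made of at most `k` shortest paths of that component (`exists_isThinPartition`): a remaining
component touches fewer than `k` earlier pieces, because these pieces touch each other, and shortest
paths to one neighbour of each make the next piece connected and adjacent to all of them. So
every piece has fewer than `k` earlier neighbours, its parents, and meets each layer of the
distances from some vertex in at most `k` vertices. Following an idea of Baker, one deletes every
`m`-th layer and then the few vertices of the piece in the remaining window of layers.
`exists_red_avoids` turns this into a strategy that reduces `G` to the empty graph; it uses a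
bounded number of single deletions and deletions of random residue classes of total cost at
most `ε`. Played at random, the strategy yields a random set of vertices that contains every vertex
with probability at most `ε` and leaves a graph of bounded treedepth (`Red.randomElim`). The
disjoint union of all the outcomes, scaled down (`deletionAverage`), has bounded treedepth, and its
opt-values are close to those of the structure: a tuple of positive value has at most `k` different
entries, so that it is destroyed with probability at most `k ε`.

*From the treedepth to the size, over bounded signatures.* The opt-values of a structure of
treedepth at most `k` are the values of a weighted forest `NTree` of height `k`, whose leaves carry
a weight for each type of tuples along a path (`exists_opt_eq_val`), and conversely
(`NTree.opt_toStructure`). There are boundedly many types, so the weighted forests of total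
weight at most `1` have a finite net with respect to the values (`NTree.exists_net`). The error in
the net is additive, relative to the largest value in the target of a single tuple. It becomes
multiplicative once all the types that occur are scaled to the same total weight: assignments that
depend on the level only show that the value of the forest is at least the total weight of any one
type times any value of a tuple of this type (`NTree.mass_mul_le_val`). Rescaling the types does
not change the number of vertices.
-/

namespace Pliability

/-! ### Connectivity inside a set of vertices -/

section Within

variable {V : Type} {G : SimpleGraph V} {S T : Set V} {u v w : V}

/-- The edges of `G` inside `S`, as a graph on all the vertices. -/
def within (G : SimpleGraph V) (S : Set V) : SimpleGraph V where
  Adj a b := G.Adj a b ∧ a ∈ S ∧ b ∈ S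
  symm := ⟨fun _ _ h => ⟨h.1.symm, h.2.2, h.2.1⟩⟩
  loopless := ⟨fun _ h => h.1.ne rfl⟩

theorem within_mono (h : S ⊆ T) : within G S ≤ within G T :=
  fun _ _ hab => ⟨hab.1, h hab.2.1, h hab.2.2⟩

/-- The connected component of `v` in the subgraph of `G` induced on `S`. -/
def comp (G : SimpleGraph V) (S : Set V) (v : V) : Set V :=
  {w | w ∈ S ∧ (within G S).Reachable v w}

/-- Any two vertices of `S` are joined by a walk of `G` inside `S`. -/
def ConnIn (G : SimpleGraph V) (S : Set V) : Prop :=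
  ∀ u ∈ S, ∀ v ∈ S, (within G S).Reachable u v

theorem reachable_within_ind {P : V → Prop} (h : (within G S).Reachable u v) (hu : P u)
    (step : ∀ a b, P a → G.Adj a b → a ∈ S → b ∈ S → P b) : P v := by
  rw [SimpleGraph.reachable_iff_reflTransGen] at h
  induction h with
  | refl => exact hu
  | tail _ hab ih => exact step _ _ ih hab.1 hab.2.1 hab.2.2

theorem mem_of_reachable_within (h : (within G S).Reachable u v) (hu : u ∈ S) : v ∈ S :=
  reachable_within_ind h hu fun _ _ _ _ _ hb => hb

theorem comp_subset : comp G S v ⊆ S := fun _ h => h.1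

theorem mem_comp_self (hv : v ∈ S) : v ∈ comp G S v := ⟨hv, .refl _⟩

theorem mem_comp_of_adj (hu : u ∈ comp G S v) (huw : G.Adj u w) (hw : w ∈ S) :
    w ∈ comp G S v :=
  ⟨hw, hu.2.trans (SimpleGraph.Adj.reachable ⟨huw, hu.1, hw⟩)⟩

theorem reachable_within_comp (hv : v ∈ S) (hw : w ∈ comp G S v) :
    (within G (comp G S v)).Reachable v w := by
  have key : w ∈ comp G S v ∧ (within G (comp G S v)).Reachable v w := by
    refine reachable_within_ind (P := fun w => w ∈ comp G S v ∧
      (within G (comp G S v)).Reachable v w) hw.2 ⟨mem_comp_self hv, .refl _⟩ ?_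
    rintro a b ⟨ha, hr⟩ hab _ hb
    have hb' := mem_comp_of_adj ha hab hb
    exact ⟨hb', hr.trans (SimpleGraph.Adj.reachable ⟨hab, ha, hb'⟩)⟩
  exact key.2

theorem connIn_comp (hv : v ∈ S) : ConnIn G (comp G S v) := fun _ ha _ hb =>
  (reachable_within_comp hv ha).symm.trans (reachable_within_comp hv hb)

theorem ConnIn.subset_comp (hT : ConnIn G T) (hTS : T ⊆ S) (hv : v ∈ T) : T ⊆ comp G S v :=
  fun _ hw => ⟨hTS hw, (hT _ hv _ hw).mono (within_mono hTS)⟩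

theorem ConnIn.subset_comp_of_adj (hT : ConnIn G T) (hTS : T ⊆ S) (hu : u ∈ comp G S v)
    (huw : G.Adj u w) (hw : w ∈ T) : T ⊆ comp G S v := fun _ hx =>
  ⟨hTS hx, (mem_comp_of_adj hu huw (hTS hw)).2.trans ((hT _ hw _ hx).mono (within_mono hTS))⟩

theorem comp_eq_of_mem (hw : w ∈ comp G S v) : comp G S w = comp G S v := by
  ext x
  exact ⟨fun h => ⟨h.1, hw.2.trans h.2⟩, fun h => ⟨h.1, hw.2.symm.trans h.2⟩⟩

theorem reachable_induce_iff (hu : u ∈ S) (hv : v ∈ S) :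
    (G.induce S).Reachable ⟨u, hu⟩ ⟨v, hv⟩ ↔ (within G S).Reachable u v := by
  constructor
  · intro h
    rw [SimpleGraph.reachable_iff_reflTransGen] at h
    have : ∀ x : S, Relation.ReflTransGen (G.induce S).Adj ⟨u, hu⟩ x →
        (within G S).Reachable u x := by
      intro x hx
      induction hx with
      | refl => exact .refl _
      | @tail b c _ hab ih =>
        exact ih.trans (SimpleGraph.Adj.reachable ⟨hab, b.2, c.2⟩)
    exact this _ h
  · intro h
    have : ∃ hv : v ∈ S, (G.induce S).Reachable ⟨u, hu⟩ ⟨v, hv⟩ := by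
      refine reachable_within_ind (P := fun v => ∃ hv : v ∈ S,
        (G.induce S).Reachable ⟨u, hu⟩ ⟨v, hv⟩) h ⟨hu, .refl _⟩ ?_
      rintro a b ⟨ha, hr⟩ hab _ hb
      refine ⟨hb, hr.trans (SimpleGraph.Adj.reachable ?_)⟩
      exact hab
    exact this.2

theorem ConnIn.connected (hS : ConnIn G S) (hne : S.Nonempty) : (G.induce S).Connected := by
  have : Nonempty S := hne.to_subtype
  exact ⟨fun x y => (reachable_induce_iff x.2 y.2).2 (hS _ x.2 _ y.2)⟩

theorem connIn_of_connected (h : (G.induce S).Connected) : ConnIn G S :=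
  fun _ hu _ hv => (reachable_induce_iff hu hv).1 (h.preconnected _ _)

theorem componentIn_eq_comp (S : Finset V) (hv : v ∈ S) :
    componentIn G S v = comp G (S : Set V) v := by
  ext w
  constructor
  · rintro ⟨_, hw, h⟩
    exact ⟨hw, (reachable_induce_iff (by exact hv) (by exact hw)).1 h⟩
  · rintro ⟨hw, h⟩
    exact ⟨hv, hw, (reachable_induce_iff (by exact hv) (by exact hw)).2 h⟩

end Within

/-! ### Partitions into connected pieces made of few shortest paths -/

section Partition

variable {V : Type} {G : SimpleGraph V} {idx : V → ℕ} {u v w : V} {i j n t : ℕ}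

/-- For a partition of the vertices into pieces numbered by `idx`, the connected component of `v`
once all the pieces with a smaller number than that of `v` are removed. -/
def desc (G : SimpleGraph V) (idx : V → ℕ) (v : V) : Set V :=
  comp G {w | idx v ≤ idx w} v

/-- Some edge joins the pieces with numbers `i` and `j`. -/
def PieceAdj (G : SimpleGraph V) (idx : V → ℕ) (i j : ℕ) : Prop :=
  ∃ u v, idx u = i ∧ idx v = j ∧ G.Adj u v

/-- The smaller numbers of the pieces adjacent to piece `j`. -/
def parents (G : SimpleGraph V) (idx : V → ℕ) (j : ℕ) : Set ℕ :=
  {i | i < j ∧ PieceAdj G idx i j}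

/-- The pieces numbered below `n` are connected, every piece touches all the earlier pieces that
its component of the graph without the earlier pieces touches, and that component has a layering
with at most `t` vertices of the piece in each layer. The pieces from `n` on are not
constrained. -/
structure IsThinPartition (G : SimpleGraph V) (idx : V → ℕ) (t n : ℕ) : Prop where
  conn : ∀ j < n, ConnIn G {v | idx v = j}
  pieceAdj : ∀ v, idx v < n → ∀ i < idx v, ∀ w ∈ desc G idx v, ∀ u, idx u = i → G.Adj u w →
    PieceAdj G idx i (idx v)
  thin : ∀ v, idx v < n → ∃ μ : V → ℕ,
    (∀ a ∈ desc G idx v, ∀ b ∈ desc G idx v, G.Adj a b → μ a ≤ μ b + 1) ∧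
    ∀ d, {w | idx w = idx v ∧ μ w = d}.encard ≤ t

theorem parents_finite : (parents G idx j).Finite :=
  (Set.finite_lt_nat j).subset fun _ h => h.1

theorem IsThinPartition.mono {m : ℕ} (h : IsThinPartition G idx t n) (hm : m ≤ n) :
    IsThinPartition G idx t m :=
  ⟨fun j hj => h.conn j (hj.trans_le hm), fun v hv => h.pieceAdj v (hv.trans_le hm),
    fun v hv => h.thin v (hv.trans_le hm)⟩

/-- The pieces that touch a connected set lying after them touch each other. -/
theorem IsThinPartition.pieceAdj_of_adj_connIn (h : IsThinPartition G idx t n) {K : Set V}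
    (hK : ConnIn G K) (hKn : ∀ v ∈ K, n ≤ idx v) {a b a' b' : V} (ha' : a' ∈ K) (hb' : b' ∈ K)
    (haa : G.Adj a a') (hbb : G.Adj b b') (hab : idx a < idx b) (hb : idx b < n) :
    PieceAdj G idx (idx a) (idx b) := by
  have hsub : K ⊆ desc G idx b := by
    refine hK.subset_comp_of_adj (fun x hx => hb.le.trans (hKn x hx))
      (mem_comp_self (le_refl (idx b))) hbb hb'
  exact h.pieceAdj b hb _ hab a' (hsub ha') a rfl haa

/-- A connected set together with the earlier pieces touching it contracts to a complete graph. -/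
theorem IsThinPartition.isMinor_of_connIn (h : IsThinPartition G idx t n) {K : Set V}
    (hK : ConnIn G K) (hne : K.Nonempty) (hKn : ∀ v ∈ K, n ≤ idx v) (s : Finset ℕ)
    (hs : ∀ i ∈ s, i < n ∧ ∃ u, idx u = i ∧ ∃ w ∈ K, G.Adj u w) :
    IsMinor (⊤ : SimpleGraph (Fin (s.card + 1))) G := by
  classical
  let e : Fin (s.card + 1) ≃ Option s := Fintype.equivOfCardEq (by simp)
  let br : Option s → Set V := fun o => o.elim K fun i => {v | idx v = i}
  have hadj : ∀ x y : Option s, x ≠ y → ∃ u ∈ br x, ∃ v ∈ br y, G.Adj u v := by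
    rintro (_ | i) (_ | j) hij
    · exact absurd rfl hij
    · obtain ⟨_, u, hu, w, hw, huw⟩ := hs j j.2
      exact ⟨w, hw, u, hu, huw.symm⟩
    · obtain ⟨_, u, hu, w, hw, huw⟩ := hs i i.2
      exact ⟨u, hu, w, hw, huw⟩
    · obtain ⟨hi, a, ha, a', ha', haa⟩ := hs i i.2
      obtain ⟨hj, b, hb, b', hb', hbb⟩ := hs j j.2
      have hne : (i : ℕ) ≠ j := fun h => hij (by rw [Subtype.ext h])
      rcases lt_or_gt_of_ne hne with hlt | hlt
      · obtain ⟨x, y, hx, hy, hxy⟩ :=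
          h.pieceAdj_of_adj_connIn hK hKn ha' hb' haa hbb (by omega) (by omega)
        exact ⟨x, hx.trans ha, y, hy.trans hb, hxy⟩
      · obtain ⟨x, y, hx, hy, hxy⟩ :=
          h.pieceAdj_of_adj_connIn hK hKn hb' ha' hbb haa (by omega) (by omega)
        exact ⟨y, hy.trans ha, x, hx.trans hb, hxy.symm⟩
  have hconn : ∀ x, (G.induce (br x)).Connected := by
    rintro (_ | i)
    · exact hK.connected hne
    · obtain ⟨hi, u, hu, _⟩ := hs i i.2
      exact (h.conn i hi).connected ⟨u, hu⟩
  have hdisj : ∀ x y, x ≠ y → Disjoint (br x) (br y) := by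
    rintro (_ | i) (_ | j) hxy <;> rw [Set.disjoint_left]
    · exact absurd rfl hxy
    · intro a ha (hb : idx a = j)
      have := (hs j j.2).1
      have := hKn a ha
      omega
    · intro a (hb : idx a = i) ha
      have := (hs i i.2).1
      have := hKn a ha
      omega
    · intro a (ha : idx a = i) (hb : idx a = j)
      exact hxy (by rw [Subtype.ext (ha.symm.trans hb)])
  exact ⟨fun x => br (e x), fun x => hconn _, fun x y hxy => hdisj _ _ (e.injective.ne hxy),
    fun x y hxy => hadj _ _ (e.injective.ne hxy.ne)⟩

theorem IsThinPartition.card_lt_of_not_isMinor {k : ℕ}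
    (hG : ¬ IsMinor (⊤ : SimpleGraph (Fin (k + 1))) G) (h : IsThinPartition G idx t n) {K : Set V}
    (hK : ConnIn G K) (hne : K.Nonempty) (hKn : ∀ v ∈ K, n ≤ idx v) (s : Finset ℕ)
    (hs : ∀ i ∈ s, i < n ∧ ∃ u, idx u = i ∧ ∃ w ∈ K, G.Adj u w) : s.card < k := by
  by_contra! hk
  obtain ⟨s', hs', hcard⟩ := Finset.exists_subset_card_eq hk
  have := h.isMinor_of_connIn hK hne hKn s' fun i hi => hs i (hs' hi)
  rw [hcard] at this
  exact hG this

/-- A shortest walk from `r` meets every distance layer around `r` at most once. -/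
theorem eq_of_mem_support_geodesic {H : SimpleGraph V} {r x a b : V} (p : H.Walk r x)
    (hp : p.length = H.dist r x) (ha : a ∈ p.support) (hb : b ∈ p.support)
    (hab : H.dist r a = H.dist r b) : a = b := by
  have key : ∀ a ∈ p.support, a = p.getVert (H.dist r a) := by
    intro a ha
    obtain ⟨m, rfl, hm⟩ := SimpleGraph.Walk.mem_support_iff_exists_getVert.1 ha
    congr 1
    have h1 := SimpleGraph.dist_le (p.take m)
    have h2 := SimpleGraph.dist_le (p.drop m)
    have h3 := (p.take m).reachable.dist_triangle_left x
    rw [SimpleGraph.Walk.take_length] at h1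
    rw [SimpleGraph.Walk.drop_length] at h2
    have h4 : min m p.length = m := min_eq_left hm
    omega
  rw [key a ha, key b hb, hab]

theorem reachable_within_of_mem_support {K H : Set V} {r x : V} (p : (within G K).Walk r x)
    (hp : ∀ a ∈ p.support, a ∈ H) {a : V} (ha : a ∈ p.support) : (within G H).Reachable r a := by
  induction p with
  | nil =>
    rw [SimpleGraph.Walk.mem_support_nil_iff] at ha
    rw [ha]
  | @cons u v w huv q ih =>
    rw [SimpleGraph.Walk.support_cons, List.mem_cons] at ha
    rcases ha with rfl | ha
    · exact .refl _
    · refine .trans (SimpleGraph.Adj.reachable ⟨huv.1, hp _ (by simp), hp _ (by simp)⟩)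
        (ih (fun a ha => hp a (by simp [ha])) ha)

theorem mem_of_mem_support_within {K : Set V} {r x : V} (p : (within G K).Walk r x)
    (hr : r ∈ K) {a : V} (ha : a ∈ p.support) : a ∈ K := by
  classical
  exact mem_of_reachable_within (p.takeUntil a ha).reachable hr

/-- Inside a connected set `K`, boundedly many vertices can be joined by a connected subset that
meets every layer of the layering by the distance from `r` in boundedly many vertices: a union of
shortest paths from `r`. -/
theorem exists_union_of_geodesics {K : Set V} (hK : ConnIn G K) {r : V} (hr : r ∈ K)
    (W : Finset V) (hW : ∀ x ∈ W, x ∈ K) :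
    ∃ H ⊆ K, ConnIn G H ∧ (∀ x ∈ W, x ∈ H) ∧
      ∀ d, {a | a ∈ H ∧ (within G K).dist r a = d}.encard ≤ W.card := by
  have hgeo : ∀ x : V, ∃ S : Set V, x ∈ K → r ∈ S ∧ x ∈ S ∧ S ⊆ K ∧
      (∀ a ∈ S, (within G S).Reachable r a) ∧
      ∀ a ∈ S, ∀ b ∈ S, (within G K).dist r a = (within G K).dist r b → a = b := by
    intro x
    by_cases hx : x ∈ K
    · obtain ⟨p, hp⟩ := (hK r hr x hx).exists_walk_length_eq_dist
      exact ⟨{a | a ∈ p.support}, fun _ => ⟨p.start_mem_support, p.end_mem_support,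
        fun a ha => mem_of_mem_support_within p hr ha,
        fun a ha => reachable_within_of_mem_support p (fun _ h => h) ha,
        fun a ha b hb hab => eq_of_mem_support_geodesic p hp ha hb hab⟩⟩
    · exact ⟨∅, fun h => absurd h hx⟩
  choose S hS using hgeo
  have hsub : ∀ x ∈ W, S x ⊆ ⋃ x ∈ W, S x := fun x hx => Set.subset_biUnion_of_mem (u := S) hx
  have hreach : ∀ a ∈ ⋃ x ∈ W, S x, (within G (⋃ x ∈ W, S x)).Reachable r a := by
    intro a ha
    obtain ⟨x, hx, hax⟩ := Set.mem_iUnion₂.1 ha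
    exact ((hS x (hW x hx)).2.2.2.1 a hax).mono (within_mono (hsub x hx))
  refine ⟨⋃ x ∈ W, S x, ?_, fun a ha b hb => (hreach a ha).symm.trans (hreach b hb), ?_, ?_⟩
  · exact Set.iUnion₂_subset fun x hx => (hS x (hW x hx)).2.2.1
  · exact fun x hx => hsub x hx (hS x (hW x hx)).2.1
  · intro d
    have : ∀ a, ∃ x, a ∈ (⋃ x ∈ W, S x) → x ∈ W ∧ a ∈ S x := by
      intro a
      by_cases ha : a ∈ ⋃ x ∈ W, S x
      · obtain ⟨x, hx, hax⟩ := Set.mem_iUnion₂.1 ha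
        exact ⟨x, fun _ => ⟨hx, hax⟩⟩
      · exact ⟨a, fun h => absurd h ha⟩
    choose f hf using this
    rw [← Set.encard_coe_eq_coe_finsetCard]
    refine Set.encard_le_encard_of_injOn (f := f) (fun a ha => (hf a ha.1).1) ?_
    intro a ha b hb hab
    have h1 := hf a ha.1
    have h2 := hf b hb.1
    rw [← hab] at h2
    exact (hS _ (hW _ h1.1)).2.2.2.2 a h1.2 b h2.2 (ha.2.trans hb.2.symm)

theorem dist_le_of_adj_within {K : Set V} (hK : ConnIn G K) {r a b : V} (hr : r ∈ K)
    (ha : a ∈ K) (hb : b ∈ K) (hab : G.Adj a b) :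
    (within G K).dist r a ≤ (within G K).dist r b + 1 := by
  have h := (hK r hr b hb).dist_triangle_left a
  have h1 : (within G K).dist b a = 1 := SimpleGraph.dist_eq_one_iff_adj.2 ⟨hab.symm, hb, ha⟩
  omega

/-- A thin partition can be prolonged by one piece, cut out of a component of what is left. -/
theorem IsThinPartition.exists_succ [Finite V] {k : ℕ}
    (hG : ¬ IsMinor (⊤ : SimpleGraph (Fin (k + 1))) G) (h : IsThinPartition G idx k n)
    (hn : ∀ v, idx v ≤ n) {r : V} (hr : idx r = n) :
    ∃ idx' : V → ℕ, IsThinPartition G idx' k (n + 1) ∧ (∀ v, idx' v ≤ n + 1) ∧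
      {v | idx' v = n + 1} ⊂ {v | idx v = n} := by
  classical
  set K := comp G {w | n ≤ idx w} r with hKdef
  have hrn : r ∈ {w | n ≤ idx w} := hr.ge
  have hK : ConnIn G K := connIn_comp hrn
  have hrK : r ∈ K := mem_comp_self hrn
  have hKn : ∀ v ∈ K, n ≤ idx v := fun v hv => hv.1
  let s : Finset ℕ := (Finset.range n).filter fun i => ∃ u, idx u = i ∧ ∃ w ∈ K, G.Adj u w
  have hs : ∀ i ∈ s, i < n ∧ ∃ u, idx u = i ∧ ∃ w ∈ K, G.Adj u w := by
    intro i hi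
    simpa [s] using hi
  have hsk : s.card < k := h.card_lt_of_not_isMinor hG hK ⟨r, hrK⟩ hKn s hs
  have hw : ∀ i, ∃ w ∈ K, i ∈ s → ∃ u, idx u = i ∧ G.Adj u w := by
    intro i
    by_cases hi : i ∈ s
    · obtain ⟨_, u, hu, w, hw, huw⟩ := hs i hi
      exact ⟨w, hw, fun _ => ⟨u, hu, huw⟩⟩
    · exact ⟨r, hrK, fun h => absurd h hi⟩
  choose f hfK hf using hw
  have hWcard : (insert r (s.image f)).card ≤ k :=
    (Finset.card_insert_le _ _).trans (by have := Finset.card_image_le (s := s) (f := f); omega)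
  obtain ⟨H, hHK, hH, hWH, hHd⟩ := exists_union_of_geodesics hK hrK (insert r (s.image f))
    (by
      intro x hx
      rcases Finset.mem_insert.1 hx with rfl | hx
      · exact hrK
      · obtain ⟨i, _, rfl⟩ := Finset.mem_image.1 hx
        exact hfK i)
  have hHn : ∀ v ∈ H, idx v = n := fun v hv => le_antisymm (hn v) (hKn v (hHK hv))
  let idx' : V → ℕ := fun v => if v ∈ H then n else if idx v = n then n + 1 else idx v
  have hlt : ∀ v j, j < n → (idx' v = j ↔ idx v = j) := by
    intro v j hj
    simp only [idx']
    split_ifs with h1 h2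
    · have := hHn v h1
      omega
    all_goals omega
  have hge : ∀ v j, j ≤ n → (j ≤ idx' v ↔ j ≤ idx v) := by
    intro v j hj
    have := hn v
    simp only [idx']
    split_ifs with h1 h2
    · have := hHn v h1
      omega
    all_goals omega
  have heq : ∀ v, idx' v = n ↔ v ∈ H := by
    intro v
    have := hHn v
    simp only [idx']
    split_ifs <;> simp_all
  have hle : ∀ v, idx' v ≤ n + 1 := by
    intro v
    have := hn v
    simp only [idx']
    split_ifs <;> omega
  have hset : ∀ j ≤ n, {w | j ≤ idx' w} = {w | j ≤ idx w} := fun j hj =>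
    Set.ext fun w => hge w j hj
  have hdesc : ∀ v, idx' v < n → idx' v = idx v ∧ desc G idx' v = desc G idx v := by
    intro v hv
    have h1 : idx' v = idx v := ((hlt v _ hv).1 rfl).symm
    refine ⟨h1, ?_⟩
    unfold desc
    rw [hset _ hv.le, h1]
  have hdescn : ∀ v, idx' v = n → desc G idx' v = K := by
    intro v hv
    unfold desc
    rw [hv, hset n le_rfl]
    exact comp_eq_of_mem (hHK ((heq v).1 hv))
  refine ⟨idx', ⟨?_, ?_, ?_⟩, hle, ?_⟩
  · intro j hj
    rcases Nat.lt_succ_iff_lt_or_eq.1 hj with hj | rfl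
    · rw [show {v | idx' v = j} = {v | idx v = j} from Set.ext fun v => hlt v j hj]
      exact h.conn j hj
    · rw [show {v | idx' v = j} = H from Set.ext heq]
      exact hH
  · intro v hv i hi w hw u hu huw
    rcases Nat.lt_succ_iff_lt_or_eq.1 hv with hv | hv
    · obtain ⟨h1, h2⟩ := hdesc v hv
      rw [h2] at hw
      have hin : i < n := hi.trans hv
      obtain ⟨x, y, hx, hy, hxy⟩ := h.pieceAdj v (h1 ▸ hv) i (h1 ▸ hi) w hw u
        ((hlt u i hin).1 hu) huw
      exact ⟨x, y, (hlt x i hin).2 hx, (hlt y _ hv).2 (hy.trans h1.symm), hxy⟩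
    · rw [hv] at hi ⊢
      rw [hdescn v hv] at hw
      have his : i ∈ s := by
        simp only [s, Finset.mem_filter, Finset.mem_range]
        exact ⟨hi, u, (hlt u i hi).1 hu, w, hw, huw⟩
      obtain ⟨x, hx, hxy⟩ := hf i his
      refine ⟨x, f i, (hlt x i hi).2 hx, (heq _).2 (hWH _ ?_), hxy⟩
      exact Finset.mem_insert_of_mem (Finset.mem_image_of_mem f his)
  · intro v hv
    rcases Nat.lt_succ_iff_lt_or_eq.1 hv with hv | hv
    · obtain ⟨h1, h2⟩ := hdesc v hv
      obtain ⟨μ, hμ, hd⟩ := h.thin v (h1 ▸ hv)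
      refine ⟨μ, by rwa [h2], fun d => ?_⟩
      have : {w | idx' w = idx' v ∧ μ w = d} = {w | idx w = idx v ∧ μ w = d} := by
        ext w
        simp only [Set.mem_ofPred_eq]
        rw [hlt w _ hv, h1]
      rw [this]
      exact hd d
    · refine ⟨fun a => (within G K).dist r a, ?_, fun d => ?_⟩
      · rw [hdescn v hv]
        exact fun a ha b hb hab => dist_le_of_adj_within hK hrK ha hb hab
      · have : {w | idx' w = idx' v ∧ (within G K).dist r w = d} =
            {a | a ∈ H ∧ (within G K).dist r a = d} := by
          ext w
          simp only [Set.mem_ofPred_eq]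
          rw [hv, heq]
        rw [this]
        exact (hHd d).trans (by exact_mod_cast hWcard)
  · refine Set.ssubset_iff_subset_ne.2 ⟨fun v hv => ?_, fun heq' => ?_⟩
    · have hv' : idx' v = n + 1 := hv
      have := hn v
      simp only [idx'] at hv'
      split_ifs at hv' with h1 h2
      · omega
      · exact h2
      · omega
    · have h1 : idx' r = n + 1 := by
        have : r ∈ {v | idx v = n} := hr
        rw [← heq'] at this
        exact this
      have h2 : idx' r = n := (heq r).2 (hWH r (Finset.mem_insert_self _ _))
      omega

/-- A graph without a complete minor on `k + 1` vertices has a partition into connected pieces,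
each of them the union of at most `k` paths with a common end that are shortest in the component
from which the piece is cut out. -/
theorem exists_isThinPartition [Finite V] {k : ℕ}
    (hG : ¬ IsMinor (⊤ : SimpleGraph (Fin (k + 1))) G) :
    ∃ (idx : V → ℕ) (n : ℕ), IsThinPartition G idx k n ∧ ∀ v, idx v < n := by
  have key : ∀ (c n : ℕ) (idx : V → ℕ), {v | idx v = n}.ncard ≤ c → IsThinPartition G idx k n →
      (∀ v, idx v ≤ n) → ∃ (idx : V → ℕ) (n : ℕ), IsThinPartition G idx k n ∧ ∀ v, idx v < n := by
    intro c
    induction c with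
    | zero =>
      intro n idx hc h hn
      refine ⟨idx, n, h, fun v => lt_of_le_of_ne (hn v) fun hv => ?_⟩
      have := (Set.ncard_eq_zero (Set.toFinite _)).1 (Nat.le_zero.1 hc)
      exact (this ▸ (show v ∈ {v | idx v = n} from hv) : v ∈ (∅ : Set V))
    | succ c ih =>
      intro n idx hc h hn
      by_cases hr : ∃ r, idx r = n
      · obtain ⟨r, hr⟩ := hr
        obtain ⟨idx', h', hn', hss⟩ := h.exists_succ hG hn hr
        refine ih (n + 1) idx' ?_ h' hn'
        have := Set.ncard_lt_ncard hss (Set.toFinite _)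
        omega
      · exact ⟨idx, n, h, fun v => lt_of_le_of_ne (hn v) fun hv => hr ⟨v, hv⟩⟩
  refine key _ 0 (fun _ => 0) le_rfl ⟨?_, ?_, ?_⟩ fun _ => le_rfl <;> intro j hj <;> omega

end Partition

/-! ### Reducing a graph by layerings and deletions -/

section Reduction

variable {V : Type} {G : SimpleGraph V} {P Q : Set V → Prop} {S T : Set V} {ε δ : ℚ} {k l : ℕ}

/-- `Red G P ε k S`: the vertex set `S` can be reduced to sets satisfying `P` by a strategy that
deletes at most `k` chosen vertices along each branch, passes to connected components, and deletes
a residue class of a numbering `lam` of the vertices modulo `m`, where the strategy has to go on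
for each of the `m` residues. The cost of the last operation is `1 / m`, the probability with
which a random residue hits a given vertex, and `ε` bounds the total cost along each branch. -/
inductive Red (G : SimpleGraph V) (P : Set V → Prop) : ℚ → ℕ → Set V → Prop
  | base {S : Set V} : P S → Red G P 0 0 S
  | comps {ε : ℚ} {k : ℕ} {S : Set V} : 0 ≤ ε → (∀ v ∈ S, Red G P ε k (comp G S v)) → Red G P ε k S
  | del {ε : ℚ} {k : ℕ} {S : Set V} (v : V) : Red G P ε k (S \ {v}) → Red G P ε (k + 1) S
  | layer {ε : ℚ} {k : ℕ} {S : Set V} (m : ℕ) (lam : V → ℕ) : 0 < m →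
      (∀ i < m, Red G P ε k (S \ {v | lam v % m = i})) → Red G P (ε + 1 / m) k S
  | mono {ε δ : ℚ} {k l : ℕ} {S : Set V} : ε ≤ δ → k ≤ l → Red G P ε k S → Red G P δ l S

theorem Red.of_base (hε : 0 ≤ ε) (h : P S) : Red G P ε k S :=
  .mono hε (Nat.zero_le k) (.base h)

theorem Red.bind (hδ : 0 ≤ δ) (h : Red G P ε k S) (hQ : ∀ T ⊆ S, P T → Red G Q δ l T) :
    Red G Q (ε + δ) (k + l) S := by
  induction h with
  | base hP =>
    rw [zero_add, zero_add]
    exact hQ _ subset_rfl hP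
  | comps hε _ ih =>
    exact .comps (by positivity) fun v hv => ih v hv fun T hT => hQ T (hT.trans comp_subset)
  | del v _ ih =>
    rw [Nat.add_right_comm]
    exact .del v (ih fun T hT => hQ T (hT.trans Set.sdiff_subset))
  | layer m lam hm _ ih =>
    rw [add_right_comm]
    exact .layer m lam hm fun i hi => ih i hi fun T hT => hQ T (hT.trans Set.sdiff_subset)
  | mono h1 h2 _ ih => exact .mono (by linarith) (by omega) (ih hQ)

theorem Red.del_set {D : Set V} {d : ℕ} (hD : D.encard ≤ d) (h : Red G P ε k (S \ D)) :
    Red G P ε (k + d) S := by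
  induction d generalizing S D with
  | zero =>
    have : D = ∅ := by simpa using hD
    rwa [this, Set.sdiff_empty] at h
  | succ d ih =>
    rcases D.eq_empty_or_nonempty with rfl | ⟨v, hv⟩
    · rw [Set.sdiff_empty] at h
      exact .mono le_rfl (by omega) h
    · have hd : (D \ {v}).encard ≤ d := by
        have := Set.encard_sdiff_singleton_add_one hv
        rw [← this] at hD
        exact (ENat.add_le_add_iff_right ENat.one_ne_top).1 (by exact_mod_cast hD)
      refine .del v (ih hd ?_)
      rwa [Set.sdiff_sdiff, Set.union_sdiff_cancel (Set.singleton_subset_iff.2 hv)]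

/-- After the deletion of a residue class of a layering modulo `m`, every connected component lies
within `m` consecutive layers. -/
theorem Red.window {m : ℕ} (hm : 0 < m) (hε : 0 ≤ ε) (lam : V → ℕ)
    (hlam : ∀ a ∈ S, ∀ b ∈ S, G.Adj a b → lam a ≤ lam b + 1)
    (h : ∀ T ⊆ S, ∀ b, (∀ v ∈ T, b ≤ lam v + m ∧ lam v < b) → Red G P ε k T) :
    Red G P (ε + 1 / m) k S := by
  refine .layer m lam hm fun i hi => .comps hε fun v hv => ?_
  -- The numbers strictly between two consecutive ones of residue `i` are those with the same value
  -- of `(x + (m - i)) / m`, and this value is constant on the component.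
  refine h _ (comp_subset.trans Set.sdiff_subset) ((lam v + (m - i)) / m * m + i) fun w hw => ?_
  have hstep : ∀ a ∈ S \ {v | lam v % m = i}, ∀ b ∈ S \ {v | lam v % m = i}, lam b = lam a + 1 →
      (lam b + (m - i)) / m = (lam a + (m - i)) / m := by
    intro a ha b hb hab
    rw [hab, Nat.add_right_comm, Nat.succ_div, if_neg, add_zero]
    intro hdvd
    apply hb.2
    obtain ⟨c, hc⟩ := hdvd
    show lam b % m = i
    rcases c with _ | c
    · omega
    · have : lam b = i + m * c := by
        rw [Nat.mul_succ] at hc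
        omega
      rw [this, Nat.add_mul_mod_self_left, Nat.mod_eq_of_lt hi]
  have hw' : (lam w + (m - i)) / m = (lam v + (m - i)) / m := by
    refine reachable_within_ind (P := fun w => (lam w + (m - i)) / m = (lam v + (m - i)) / m)
      hw.2 rfl ?_
    intro a b hP hab ha hb
    have h1 := hlam a ha.1 b hb.1 hab
    have h2 := hlam b hb.1 a ha.1 hab.symm
    rw [← hP]
    rcases lt_trichotomy (lam a) (lam b) with h3 | h3 | h3
    · exact hstep a ha b hb (by omega)
    · rw [h3]
    · exact (hstep b hb a ha (by omega)).symm
  rw [← hw']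
  have h1 := Nat.div_add_mod (lam w + (m - i)) m
  have h2 := Nat.mod_lt (lam w + (m - i)) hm
  rw [mul_comm] at h1
  omega

end Reduction

/-! ### Reducing a graph along a thin partition -/

section Baker

variable {V : Type} {G : SimpleGraph V} {idx : V → ℕ} {t n : ℕ}

/-- No vertex of `T` lies in a piece having all of `C` among its parents. -/
def Avoids (G : SimpleGraph V) (idx : V → ℕ) (C : Set ℕ) (T : Set V) : Prop :=
  ∀ v ∈ T, ¬ C ⊆ parents G idx (idx v)

/-- The graph on the numbers of the pieces of `K` with an edge wherever the graph has one
between the two pieces inside `K`. -/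
def quotientIn (G : SimpleGraph V) (idx : V → ℕ) (K : Set V) : SimpleGraph ℕ where
  Adj i j := i ≠ j ∧ ∃ u ∈ K, ∃ v ∈ K, idx u = i ∧ idx v = j ∧ G.Adj u v
  symm := ⟨fun _ _ ⟨h, u, hu, v, hv, hi, hj, huv⟩ => ⟨h.symm, v, hv, u, hu, hj, hi, huv.symm⟩⟩
  loopless := ⟨fun _ h => h.1 rfl⟩

theorem ConnIn.subset_comp_of_mem {S T : Set V} {u v : V} (hT : ConnIn G T) (hTS : T ⊆ S)
    (hu : u ∈ comp G S v) (huT : u ∈ T) : T ⊆ comp G S v := by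
  rw [← comp_eq_of_mem hu]
  exact hT.subset_comp hTS huT

theorem mem_desc_self (v : V) : v ∈ desc G idx v :=
  mem_comp_self (S := {w | idx v ≤ idx w}) (le_refl (idx v))

theorem connIn_desc (v : V) : ConnIn G (desc G idx v) :=
  connIn_comp (S := {w | idx v ≤ idx w}) (le_refl (idx v))

theorem exists_min_idx (idx : V → ℕ) {S : Set V} (hS : S.Nonempty) :
    ∃ v ∈ S, ∀ w ∈ S, idx v ≤ idx w := by
  obtain ⟨v, hv, h⟩ := (measure idx).wf.has_min S hS
  exact ⟨v, hv, fun w hw => not_lt.1 (h w hw)⟩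

theorem IsThinPartition.piece_subset (h : IsThinPartition G idx t n) (hn : ∀ v, idx v < n)
    {u v : V} (hu : u ∈ desc G idx v) : {w | idx w = idx u} ⊆ desc G idx v := by
  refine (h.conn _ (hn u)).subset_comp_of_mem (fun w (hw : idx w = idx u) => ?_) hu rfl
  have : idx v ≤ idx u := hu.1
  exact this.trans hw.ge

theorem desc_subset {u v : V} (hu : u ∈ desc G idx v) : desc G idx u ⊆ desc G idx v := by
  have h1 : idx v ≤ idx u := hu.1
  refine (connIn_desc u).subset_comp_of_mem (fun w hw => ?_) hu (mem_desc_self u)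
  have hw' : idx u ≤ idx w := hw.1
  exact h1.trans hw'

/-- If the first piece of a connected set misses some parent in `C`, so do all its pieces. -/
theorem IsThinPartition.avoids_of_first (h : IsThinPartition G idx t n) (hn : ∀ v, idx v < n)
    {S : Set V} (hS : ConnIn G S) {v : V} (hv : v ∈ S) (hmin : ∀ w ∈ S, idx v ≤ idx w) {C : Set ℕ}
    (hC : ∀ i ∈ C, i < idx v) (hCv : ¬ C ⊆ parents G idx (idx v)) : Avoids G idx C S := by
  intro w hw hCw
  refine hCv fun i hi => ⟨hC i hi, ?_⟩
  obtain ⟨_, u, x, hu, hx, hux⟩ := hCw hi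
  have hSv : S ⊆ desc G idx v := hS.subset_comp hmin hv
  exact h.pieceAdj v (hn v) i (hC i hi) x (h.piece_subset hn (hSv hw) hx) u hu hux

theorem reachable_quotientIn {v a : V} (ha : a ∈ desc G idx v) :
    (quotientIn G idx (desc G idx v)).Reachable (idx v) (idx a) := by
  have hr := connIn_desc v v (mem_desc_self v) a ha
  refine reachable_within_ind (P := fun a => (quotientIn G idx (desc G idx v)).Reachable (idx v)
    (idx a)) hr (.refl _) ?_
  intro a b hP hab ha hb
  by_cases hne : idx a = idx b
  · rwa [← hne]
  · exact hP.trans (SimpleGraph.Adj.reachable ⟨hne, a, ha, b, hb, rfl, rfl, hab⟩)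

theorem dist_quotientIn_le {v a b : V} (ha : a ∈ desc G idx v) (hb : b ∈ desc G idx v)
    (hab : G.Adj a b) :
    (quotientIn G idx (desc G idx v)).dist (idx a) (idx v) ≤
      (quotientIn G idx (desc G idx v)).dist (idx b) (idx v) + 1 := by
  by_cases hne : idx a = idx b
  · rw [hne]
    omega
  · have hadj : (quotientIn G idx (desc G idx v)).Adj (idx a) (idx b) :=
      ⟨hne, a, ha, b, hb, rfl, rfl, hab⟩
    have := hadj.reachable.dist_triangle_left (idx v)
    rw [SimpleGraph.dist_eq_one_iff_adj.2 hadj] at this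
    omega

/-- Going down from a piece `idx v` of `desc r` other than the first one, the distance to the first
piece grows, except at pieces sharing with `idx v` a parent in `desc r`: a walk to the first piece
has to leave `desc v` through a parent of `idx v`. -/
theorem IsThinPartition.dist_lt_or_exists_parent (h : IsThinPartition G idx t n)
    (hn : ∀ v, idx v < n) {r v w : V} (hv : v ∈ desc G idx r) (hvr : idx v ≠ idx r)
    (hw : w ∈ desc G idx v) :
    (quotientIn G idx (desc G idx r)).dist (idx v) (idx r) <
        (quotientIn G idx (desc G idx r)).dist (idx w) (idx r) ∨
      ∃ x, idx r ≤ x ∧ x ∈ parents G idx (idx w) ∧ x ∈ parents G idx (idx v) := by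
  set Q := quotientIn G idx (desc G idx r) with hQ
  have key : ∀ i j (p : Q.Walk i j), j = idx r → ∀ w ∈ desc G idx v, idx w = i →
      Q.dist (idx v) (idx r) < p.length ∨ Q.dist (idx v) (idx r) ≤ p.length ∧
      ∃ x, idx r ≤ x ∧ x ∈ parents G idx i ∧ x ∈ parents G idx (idx v) := by
    intro i j p
    induction p with
    | nil =>
      intro hj w hw hwi
      have h1 : idx v ≤ idx w := hw.1
      have h2 : idx r ≤ idx v := hv.1
      omega
    | @cons i i' j hadj q ih =>
      intro hj w hw hwi
      obtain ⟨hne, a, ha, b, hb, hai, hbi, hab⟩ := id hadj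
      have hav : a ∈ desc G idx v := h.piece_subset hn hw (hai.trans hwi.symm)
      have hva : idx v ≤ idx a := hav.1
      have hrb : idx r ≤ idx b := hb.1
      rw [SimpleGraph.Walk.length_cons]
      by_cases hlt : idx v ≤ idx b
      · have hbv : b ∈ desc G idx v := mem_comp_of_adj hav hab hlt
        rcases ih hj b hbv hbi with h1 | h1
        · left; omega
        · left; omega
      · right
        have hpb : PieceAdj G idx (idx b) (idx v) :=
          h.pieceAdj v (hn v) (idx b) (by omega) a hav b rfl hab.symm
        obtain ⟨x, y, hx, hy, hxy⟩ := hpb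
        have hd := dist_quotientIn_le (h.piece_subset hn hv hy) (h.piece_subset hn hb hx) hxy.symm
        rw [hx, hy, ← hQ, hbi] at hd
        subst hj
        refine ⟨hd.trans (Nat.succ_le_succ (SimpleGraph.dist_le q)), idx b, hrb,
          ⟨by omega, b, a, rfl, hai, hab.symm⟩, ⟨by omega, x, y, hx, hy, hxy⟩⟩
  obtain ⟨p, hp⟩ := (reachable_quotientIn (desc_subset hv hw)).symm.exists_walk_length_eq_dist
  have := key _ _ p rfl w hw rfl
  rw [hp] at this
  exact this.imp id fun h => h.2

/-- Reductions that avoid `insert p C`, for single numbers `p`, are carried out one after the other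
for all `p` in a finite set. -/
theorem red_avoids_insert {C : Set ℕ} {ε : ℚ} {k : ℕ} (hε : 0 ≤ ε)
    (hs : ∀ p ∉ C, ∀ T, (∀ v ∈ T, ∀ i ∈ insert p C, i < idx v) →
      Red G (Avoids G idx (insert p C)) ε k T)
    (F : Finset ℕ) {T : Set V} (hF : ∀ p ∈ F, p ∉ C) (hFT : ∀ v ∈ T, ∀ p ∈ F, p < idx v)
    (hCT : ∀ v ∈ T, ∀ i ∈ C, i < idx v) :
    Red G (fun T => ∀ p ∈ F, Avoids G idx (insert p C) T) (F.card * ε) (F.card * k) T := by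
  induction F using Finset.induction_on generalizing T with
  | empty => exact .of_base (by simp) (by simp)
  | insert p F hp ih =>
    have h1 : Red G (Avoids G idx (insert p C)) ε k T := by
      refine hs p (hF p (by simp)) T fun v hv i hi => ?_
      rcases Set.mem_insert_iff.1 hi with rfl | hi
      · exact hFT v hv _ (by simp)
      · exact hCT v hv i hi
    rw [Finset.card_insert_of_notMem hp]
    refine .mono (le_of_eq (by push_cast; ring)) (le_of_eq (by ring))
      (h1.bind (δ := F.card * ε) (l := F.card * k) (by positivity) fun T' hT' hav => ?_)
    have h2 := (ih (T := T') (fun p hp => hF p (by simp [hp]))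
      (fun v hv p hp => hFT v (hT' hv) p (by simp [hp])) (fun v hv => hCT v (hT' hv)))
    have h3 := h2.bind (Q := fun T => ∀ q ∈ insert p F, Avoids G idx (insert q C) T) (δ := 0)
      (l := 0) le_rfl fun T'' hT'' hav' => .base fun q hq => ?_
    · simpa using h3
    · rcases Finset.mem_insert.1 hq with rfl | hq
      · exact fun v hv => hav v (hT'' hv)
      · exact hav' q hq

/-- The pieces that have all of `C` as parents are eliminated distance by distance from the first
piece of `desc r`: those of least distance share a further parent with the first piece of their
component. -/
theorem IsThinPartition.red_layers [Finite V] (h : IsThinPartition G idx t n)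
    (hn : ∀ v, idx v < n) (ht : ∀ v, ∀ F : Finset ℕ, ↑F ⊆ parents G idx (idx v) → F.card ≤ t)
    {C : Set ℕ} {r : V} (hC : C ⊆ parents G idx (idx r)) {ε : ℚ} {k : ℕ} (hε : 0 ≤ ε)
    (hs : ∀ p ∉ C, ∀ T, (∀ v ∈ T, ∀ i ∈ insert p C, i < idx v) →
      Red G (Avoids G idx (insert p C)) ε k T) (b q : ℕ) {T : Set V} (hT : T ⊆ desc G idx r)
    (hTr : ∀ v ∈ T, idx v ≠ idx r)
    (hTb : ∀ v ∈ T, C ⊆ parents G idx (idx v) →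
      b ≤ (quotientIn G idx (desc G idx r)).dist (idx v) (idx r) + q ∧
      (quotientIn G idx (desc G idx r)).dist (idx v) (idx r) < b) :
    Red G (Avoids G idx C) (q * (t * ε)) (q * (t * k)) T := by
  induction q generalizing T with
  | zero =>
    refine .of_base (by simp) fun v hv hCv => ?_
    have := hTb v hv hCv
    omega
  | succ q ih =>
    refine .comps (by positivity) fun v' hv' => ?_
    obtain ⟨v, hv, hmin⟩ := exists_min_idx idx ⟨v', mem_comp_self (G := G) hv'⟩
    have hsub : comp G T v' ⊆ T := comp_subset
    have hconn : ConnIn G (comp G T v') := connIn_comp hv'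
    generalize comp G T v' = T₀ at hv hmin hsub hconn
    have hvr : v ∈ desc G idx r := hT (hsub hv)
    have hrv : idx r ≤ idx v := hvr.1
    have hClt : ∀ w ∈ T₀, ∀ i ∈ C, i < idx w := fun w hw i hi =>
      (hC hi).1.trans_le (hrv.trans (hmin w hw))
    by_cases hCv : C ⊆ parents G idx (idx v)
    · have hfin : (parents G idx (idx v) \ C).Finite := parents_finite.subset Set.sdiff_subset
      have hcard : hfin.toFinset.card ≤ t := ht v _ (by simp)
      have h1 := red_avoids_insert hε hs hfin.toFinset (T := T₀) (by simp)
        (fun w hw p hp => by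
          have hp' : p ∈ parents G idx (idx v) := (hfin.mem_toFinset.1 hp).1
          exact hp'.1.trans_le (hmin w hw)) hClt
      have hcard' : (hfin.toFinset.card : ℚ) ≤ t := by exact_mod_cast hcard
      have h2 : (hfin.toFinset.card : ℚ) * ε ≤ t * ε := by gcongr
      refine .mono ?_ ?_ (h1.bind (δ := q * (t * ε)) (l := q * (t * k)) (by positivity)
        fun T' hT' hav => ?_)
      · push_cast
        linarith
      · have := Nat.mul_le_mul_right k hcard
        rw [Nat.succ_mul]
        omega
      · refine ih (hT'.trans (hsub.trans hT)) (fun w hw => hTr w (hsub (hT' hw))) ?_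
        intro w hw hCw
        obtain ⟨h3, h4⟩ := hTb w (hsub (hT' hw)) hCw
        obtain ⟨h5, h6⟩ := hTb v (hsub hv) hCv
        refine ⟨?_, h4⟩
        have hwv : w ∈ desc G idx v := hconn.subset_comp hmin hv (hT' hw)
        rcases h.dist_lt_or_exists_parent hn hvr (hTr v (hsub hv)) hwv with h7 | ⟨x, hx, hxw, hxv⟩
        · omega
        · exfalso
          have hxC : x ∉ C := fun hxC => absurd (hC hxC).1 (not_lt.2 hx)
          exact hav x (hfin.mem_toFinset.2 ⟨hxv, hxC⟩) w hw (Set.insert_subset hxw hCw)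
    · exact .of_base (by positivity)
        (h.avoids_of_first hn hconn hv hmin (hClt v hv) hCv)

theorem encard_window_le {H : Set V} {μ : V → ℕ} (hH : ∀ d, {w | w ∈ H ∧ μ w = d}.encard ≤ t)
    (b m : ℕ) : {w | w ∈ H ∧ b ≤ μ w + m ∧ μ w < b}.encard ≤ (m * t : ℕ) := by
  induction m with
  | zero =>
    have : {w | w ∈ H ∧ b ≤ μ w + 0 ∧ μ w < b} = ∅ := by
      ext w
      simp only [Set.mem_ofPred_eq, Set.mem_empty_iff_false, iff_false]
      omega
    rw [this]
    simp
  | succ m ih =>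
    have hsub : {w | w ∈ H ∧ b ≤ μ w + (m + 1) ∧ μ w < b} ⊆
        {w | w ∈ H ∧ b ≤ μ w + m ∧ μ w < b} ∪ {w | w ∈ H ∧ μ w = b - (m + 1)} := by
      rintro w ⟨h1, h2, h3⟩
      by_cases h4 : b ≤ μ w + m
      · exact .inl ⟨h1, h4, h3⟩
      · exact .inr ⟨h1, by omega⟩
    refine (Set.encard_le_encard hsub).trans ((Set.encard_union_le _ _).trans ?_)
    rw [Nat.succ_mul]
    push_cast
    exact add_le_add (by exact_mod_cast ih) (hH _)

/-- For every set `C` of at least `t - s` numbers, the pieces that have all of `C` as parents can be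
removed by a reduction whose cost and number of deletions do not depend on the graph. If `s = 0`
there are no such pieces, as every piece has fewer than `t` parents. In the induction step, the
pieces that share a further parent with the first piece of the current component are removed by
the induction hypothesis, and `IsThinPartition.red_layers` reaches the others. -/
theorem exists_red_avoids (t s : ℕ) (ε : ℚ) (hε : 0 < ε) :
    ∃ k : ℕ, ∀ (V : Type) [Finite V] (G : SimpleGraph V) (idx : V → ℕ) (n : ℕ),
      IsThinPartition G idx t n → (∀ v, idx v < n) →
      (∀ v, ∀ F : Finset ℕ, ↑F ⊆ parents G idx (idx v) → F.card < t) →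
      ∀ (C : Finset ℕ) (S : Set V), t ≤ C.card + s → (∀ v ∈ S, ∀ i ∈ C, i < idx v) →
      Red G (Avoids G idx C) ε k S := by
  induction s generalizing ε with
  | zero =>
    refine ⟨0, fun V _ G idx n h hn ht C S hC hS => .of_base hε.le fun v hv hCv => ?_⟩
    have := ht v C hCv
    omega
  | succ s ih =>
    obtain ⟨m', hm'⟩ := exists_nat_one_div_lt (show 0 < ε / 3 by positivity)
    obtain ⟨m, rfl⟩ : ∃ m, m = m' + 1 := ⟨_, rfl⟩
    set m := m' + 1 with hm
    have hmpos : 0 < m := Nat.succ_pos m'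
    have hm3 : (1 : ℚ) / m ≤ ε / 3 := by
      rw [hm]; push_cast; exact hm'.le
    have hε' : 0 < ε / (3 * m * (t + 1)) := by positivity
    obtain ⟨k, hk⟩ := ih _ hε'
    refine ⟨m * (t * k) + m * t, fun V _ G idx n h hn ht C S hC hS => ?_⟩
    have hmt : (m : ℚ) * (t * (ε / (3 * m * (t + 1)))) ≤ ε / 3 := by
      have h1 : (m : ℚ) * (t * (ε / (3 * m * (t + 1)))) = ε / 3 * (t / (t + 1)) := by
        field_simp
      have h2 : (t : ℚ) / (t + 1) ≤ 1 := by
        rw [div_le_one (by positivity)]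
        linarith
      rw [h1]
      exact mul_le_of_le_one_right (by positivity) h2
    refine .comps hε.le fun v' hv' => ?_
    obtain ⟨r, hr, hmin⟩ := exists_min_idx idx ⟨v', mem_comp_self (G := G) hv'⟩
    have hsub : comp G S v' ⊆ S := comp_subset
    have hconn : ConnIn G (comp G S v') := connIn_comp hv'
    generalize comp G S v' = S₀ at hr hmin hsub hconn
    by_cases hCr : (C : Set ℕ) ⊆ parents G idx (idx r)
    swap
    · exact .of_base hε.le (h.avoids_of_first hn hconn hr hmin (hS r (hsub hr)) hCr)
    have hSr : S₀ ⊆ desc G idx r := hconn.subset_comp hmin hr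
    obtain ⟨μ, hμ, hthin⟩ := h.thin r (hn r)
    -- A third of the cost restricts the set to a window of `m` layers of the piece of `r`, which
    -- is then deleted, a third restricts it to pieces at a window of `m` distances from `r`, and a
    -- third pays for the reduction distance by distance.
    refine .mono (ε := (m * (t * (ε / (3 * m * (t + 1)))) + 1 / m) + 1 / m) (by linarith) le_rfl
      (.window hmpos (by positivity) μ (fun a ha b hb => hμ a (hSr ha) b (hSr hb))
        fun T hT b hTb => ?_)
    refine .del_set (encard_window_le hthin b m) (.window hmpos (by positivity)
      (fun a => (quotientIn G idx (desc G idx r)).dist (idx a) (idx r))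
      (fun a ha b hb => dist_quotientIn_le (hSr (hT ha.1)) (hSr (hT hb.1)))
      fun T' hT' b' hTb' => ?_)
    refine h.red_layers hn (fun v F hF => (ht v F hF).le) hCr hε'.le ?_ b' m
      (hT'.trans (Set.sdiff_subset.trans (hT.trans hSr))) ?_ (fun v hv _ => hTb' v hv)
    · intro p hp U hU
      have := hk V G idx n h hn ht (insert p C) U
        (by rw [Finset.card_insert_of_notMem (by simpa using hp)]; omega)
        (fun v hv i hi => hU v hv i (by simpa using hi))
      simpa using this
    · intro v hv hvr
      exact (hT' hv).2 ⟨hvr, hTb v (hT' hv).1⟩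

/-- Graphs without a complete minor on `k + 1` vertices reduce to the empty graph with arbitrarily
small cost and boundedly many deletions. -/
theorem exists_red_empty (k : ℕ) (ε : ℚ) (hε : 0 < ε) :
    ∃ d : ℕ, ∀ (V : Type) [Finite V] (G : SimpleGraph V),
      ¬ IsMinor (⊤ : SimpleGraph (Fin (k + 1))) G → Red G (· = ∅) ε d Set.univ := by
  obtain ⟨d, hd⟩ := exists_red_avoids k k ε hε
  refine ⟨d, fun V _ G hG => ?_⟩
  obtain ⟨idx, n, h, hn⟩ := exists_isThinPartition hG
  have h1 := hd V G idx n h hn (fun v F hF => ?_) ∅ Set.univ (by simp) (by simp)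
  · have h2 := h1.bind (Q := (· = ∅)) (δ := 0) (l := 0) le_rfl fun T _ hT => .base ?_
    · simpa using h2
    · exact Set.eq_empty_of_forall_notMem fun v hv => hT v hv (by simp)
  · refine (h.mono (hn v).le).card_lt_of_not_isMinor hG (h.conn _ (hn v)) ⟨v, rfl⟩
      (fun w (hw : idx w = idx v) => hw.ge) F fun i hi => ?_
    obtain ⟨hlt, u, w, hu, hw, huw⟩ := hF hi
    exact ⟨hlt, u, hu, w, hw, huw⟩

end Baker

/-! ### Elimination height and treedepth -/

section Elimination

variable {V W : Type} {G : SimpleGraph V} {S T : Set V} {m n : ℕ}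

/-- `Elim G n S`: the subgraph of `G` induced on `S` has treedepth at most `n`, in the form of an
elimination that deletes vertices and splits off parts without edges between them. -/
inductive Elim (G : SimpleGraph V) : ℕ → Set V → Prop
  | empty (n : ℕ) : Elim G n ∅
  | vertex {n : ℕ} {S : Set V} (v : V) : v ∈ S → Elim G n (S \ {v}) → Elim G (n + 1) S
  | union {n : ℕ} {S T : Set V} : Elim G n S → Elim G n T → Disjoint S T →
      (∀ a ∈ S, ∀ b ∈ T, ¬ G.Adj a b) → Elim G n (S ∪ T)

theorem Elim.mono (h : Elim G n S) (hnm : n ≤ m) : Elim G m S := by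
  induction h generalizing m with
  | empty => exact .empty m
  | vertex v hv _ ih =>
    obtain ⟨m, rfl⟩ : ∃ m', m = m' + 1 := ⟨m - 1, by omega⟩
    exact .vertex v hv (ih (by omega))
  | union _ _ hd he ih1 ih2 => exact .union (ih1 hnm) (ih2 hnm) hd he

theorem Elim.of_sdiff (v : V) (h : Elim G n (S \ {v})) : Elim G (n + 1) S := by
  by_cases hv : v ∈ S
  · exact .vertex v hv h
  · rw [Set.sdiff_singleton_eq_self hv] at h
    exact h.mono (Nat.le_succ n)

theorem Elim.comap (h : Elim G n S) {H : SimpleGraph W} {T : Set W} (f : W → V)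
    (hf : Set.InjOn f T) (hTS : Set.MapsTo f T S)
    (hadj : ∀ a ∈ T, ∀ b ∈ T, H.Adj a b → G.Adj (f a) (f b)) : Elim H n T := by
  induction h generalizing T with
  | empty =>
    rw [Set.eq_empty_of_forall_notMem fun x hx => hTS hx]
    exact .empty _
  | @vertex n S v _ _ ih =>
    by_cases hv : ∃ w ∈ T, f w = v
    · obtain ⟨w, hw, rfl⟩ := hv
      refine .vertex w hw (ih (hf.mono Set.sdiff_subset) (fun x hx => ⟨hTS hx.1, fun h => ?_⟩)
        fun a ha b hb => hadj a ha.1 b hb.1)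
      exact hx.2 (hf hx.1 hw h)
    · exact (ih hf (fun x hx => ⟨hTS hx, fun h => hv ⟨x, hx, h⟩⟩) hadj).mono (Nat.le_succ n)
  | @union n S₁ S₂ _ _ hd he ih1 ih2 =>
    have hT : T = (T ∩ f ⁻¹' S₁) ∪ (T ∩ f ⁻¹' S₂) := by
      rw [← Set.inter_union_distrib_left, ← Set.preimage_union]
      exact (Set.inter_eq_left.2 hTS).symm
    rw [hT]
    refine .union
      (ih1 (hf.mono Set.inter_subset_left) (fun x hx => hx.2)
        fun a ha b hb => hadj a ha.1 b hb.1)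
      (ih2 (hf.mono Set.inter_subset_left) (fun x hx => hx.2)
        fun a ha b hb => hadj a ha.1 b hb.1) ?_ fun a ha b hb hab => ?_
    · exact Set.disjoint_left.2 fun x hx hx' => Set.disjoint_left.1 hd hx.2 hx'.2
    · exact he _ ha.2 _ hb.2 (hadj a ha.1 b hb.1 hab)

theorem Elim.subset (h : Elim G n S) (hTS : T ⊆ S) : Elim G n T :=
  h.comap id (Set.injOn_id _) hTS fun _ _ _ _ => id

/-- A set can be eliminated part by part, when a labelling of the parts is constant on edges. -/
theorem Elim.of_label {ι : Type*} [Finite ι] (f : V → ι)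
    (hf : ∀ a ∈ S, ∀ b ∈ S, G.Adj a b → f a = f b) (h : ∀ i, Elim G n {v | v ∈ S ∧ f v = i}) :
    Elim G n S := by
  classical
  have key : ∀ s : Finset ι, Elim G n {v | v ∈ S ∧ f v ∈ s} := by
    intro s
    induction s using Finset.induction_on with
    | empty => simpa using Elim.empty n
    | insert i s hi ih =>
      have hs : {v | v ∈ S ∧ f v ∈ insert i s} =
          {v | v ∈ S ∧ f v = i} ∪ {v | v ∈ S ∧ f v ∈ s} := by
        ext v
        simp only [Finset.mem_insert, Set.mem_ofPred_eq, Set.mem_union]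
        tauto
      rw [hs]
      refine .union (h i) ih (Set.disjoint_left.2 ?_) ?_
      · rintro v ⟨_, rfl⟩ ⟨_, hv⟩
        exact hi hv
      · rintro a ⟨ha, rfl⟩ b ⟨hb, hbs⟩ hab
        exact hi (hf a ha b hb hab ▸ hbs)
  have := Fintype.ofFinite ι
  simpa using key Finset.univ

theorem elim_one_of_not_adj [Finite V] (h : ∀ a ∈ S, ∀ b ∈ S, ¬ G.Adj a b) : Elim G 1 S := by
  refine .of_label id (fun a ha b hb hab => absurd hab (h a ha b hb)) fun v => .of_sdiff v ?_
  have : {w | w ∈ S ∧ id w = v} \ {v} = ∅ := by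
    ext w
    simp only [id, Set.mem_sdiff, Set.mem_ofPred_eq, Set.mem_singleton_iff,
      Set.mem_empty_iff_false, iff_false]
    tauto
  rw [this]
  exact .empty 0

theorem elim_zero (h : Elim G 0 S) : S = ∅ := by
  generalize hn : 0 = n at h
  induction h with
  | empty => rfl
  | vertex => omega
  | union _ _ _ _ ih1 ih2 => rw [ih1 hn, ih2 hn, Set.union_empty]

/-- The elimination of a connected set can start with one of its vertices. -/
theorem Elim.exists_vertex (h : Elim G (n + 1) S) (hS : ConnIn G S) (hne : S.Nonempty) :
    ∃ v ∈ S, Elim G n (S \ {v}) := by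
  generalize hm : n + 1 = m at h
  induction h generalizing n with
  | empty => exact absurd hne Set.not_nonempty_empty
  | @vertex m' S v hv h _ =>
    obtain rfl : n = m' := by omega
    exact ⟨v, hv, h⟩
  | @union m' S T _ _ hd he ih1 ih2 =>
    rcases S.eq_empty_or_nonempty with rfl | ⟨a, ha⟩
    · rw [Set.empty_union] at hS hne ⊢
      exact ih2 hS hne hm
    rcases T.eq_empty_or_nonempty with rfl | ⟨b, hb⟩
    · rw [Set.union_empty] at hS hne ⊢
      exact ih1 hS hne hm
    exfalso
    have : b ∈ S := reachable_within_ind (P := (· ∈ S)) (hS a (.inl ha) b (.inr hb)) ha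
      fun x y hx hxy _ hy => hy.resolve_right fun hy' => he x hx y hy' hxy
    exact Set.disjoint_left.1 hd this hb

theorem treedepthOn_le_of_elim {F : Finset V} (h : Elim G n (F : Set V)) :
    treedepthOn G F ≤ n := by
  classical
  induction hc : F.card using Nat.strong_induction_on generalizing F n with
  | _ c ih =>
  subst hc
  rw [treedepthOn]
  split_ifs with hne hconn hcard
  · rcases n with _ | n
    · rw [Finset.coe_eq_empty.1 (elim_zero h)] at hne
      exact absurd hne Finset.not_nonempty_empty
    · omega
  · rcases n with _ | n
    · rw [Finset.coe_eq_empty.1 (elim_zero h)] at hne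
      exact absurd hne Finset.not_nonempty_empty
    · obtain ⟨v, hv, hv'⟩ := h.exists_vertex (connIn_of_connected hconn) hne
      rw [← Finset.coe_erase] at hv'
      have h1 := ih _ (Finset.card_erase_lt_of_mem hv) hv' rfl
      have h2 := Finset.inf'_le (f := fun v : F => treedepthOn G (F.erase v.1))
        (Finset.mem_attach F ⟨v, hv⟩)
      exact Nat.succ_le_succ (h2.trans h1)
  · refine Finset.sup_le fun v _ => ?_
    have hlt := filter_componentIn_card_lt G F v v.2 hconn
    exact ih _ hlt (h.subset (Finset.coe_subset.2 (Finset.filter_subset _ _))) rfl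
  · exact Nat.zero_le n

theorem elim_of_treedepthOn_le [Finite V] {F : Finset V} (h : treedepthOn G F ≤ n) :
    Elim G n (F : Set V) := by
  classical
  induction hc : F.card using Nat.strong_induction_on generalizing F n with
  | _ c ih =>
  subst hc
  rw [treedepthOn] at h
  split_ifs at h with hne hconn hcard
  · obtain ⟨v, rfl⟩ := Finset.card_eq_one.1 hcard
    refine (Elim.of_sdiff v ?_ : Elim G 1 _).mono h
    simpa using Elim.empty 0
  · obtain ⟨v, _, hv⟩ := Finset.exists_mem_eq_inf' (s := F.attach) (by simpa using hne)
      (fun v : F => treedepthOn G (F.erase v.1))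
    rw [hv] at h
    obtain ⟨n, rfl⟩ : ∃ m, n = m + 1 := ⟨n - 1, by omega⟩
    have := ih _ (Finset.card_erase_lt_of_mem v.2) (Nat.le_of_succ_le_succ h) rfl
    rw [Finset.coe_erase] at this
    exact .of_sdiff _ this
  · refine .of_label (fun v => comp G F v) (fun a ha b hb hab => ?_) fun K => ?_
    · exact (comp_eq_of_mem (mem_comp_of_adj (mem_comp_self ha) hab hb)).symm
    · by_cases hK : ∃ v ∈ F, comp G F v = K
      · obtain ⟨v, hv, rfl⟩ := hK
        have hlt := filter_componentIn_card_lt G F v hv hconn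
        have hle := (Finset.sup_le_iff.1 h) ⟨v, hv⟩ (Finset.mem_attach _ _)
        refine (ih _ hlt hle rfl).subset fun w hw => ?_
        rw [Finset.coe_filter]
        refine ⟨hw.1, ?_⟩
        show w ∈ componentIn G F v
        rw [componentIn_eq_comp F hv, ← hw.2]
        exact mem_comp_self hw.1
      · have : {v | v ∈ (F : Set V) ∧ comp G F v = K} = ∅ := by
          ext w
          simp only [Set.mem_ofPred_eq, Set.mem_empty_iff_false, iff_false]
          exact fun hw => hK ⟨w, hw.1, hw.2⟩
        rw [this]
        exact .empty n
  · rw [Finset.not_nonempty_iff_eq_empty.1 hne, Finset.coe_empty]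
    exact .empty n

theorem treedepth_le_iff_elim [Fintype V] : treedepth V G ≤ n ↔ Elim G n Set.univ := by
  rw [treedepth, ← Finset.coe_univ]
  exact ⟨elim_of_treedepthOn_le, treedepthOn_le_of_elim⟩

theorem elim_of_encard_le {n : ℕ} (h : S.encard ≤ n) : Elim G n S := by
  induction n generalizing S with
  | zero =>
    have : S = ∅ := by simpa using h
    rw [this]
    exact .empty 0
  | succ n ih =>
    rcases S.eq_empty_or_nonempty with rfl | ⟨v, hv⟩
    · exact .empty _
    · refine .vertex v hv (ih ?_)
      rw [← Set.encard_sdiff_singleton_add_one hv] at h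
      exact (ENat.add_le_add_iff_right ENat.one_ne_top).1 (by exact_mod_cast h)

theorem treedepth_le_maxComponentSize [Fintype V] : treedepth V G ≤ maxComponentSize V G := by
  rw [treedepth_le_iff_elim]
  refine .of_label G.connectedComponentMk (fun a _ b _ hab => ?_) fun c => ?_
  · exact SimpleGraph.ConnectedComponent.sound hab.reachable
  · apply elim_of_encard_le
    have h1 : {v | v ∈ Set.univ ∧ G.connectedComponentMk v = c} = c.supp := by
      ext v
      simp [SimpleGraph.ConnectedComponent.mem_supp_iff]
    rw [h1, ← (Set.toFinite c.supp).cast_ncard_eq]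
    have := le_ciSup (f := fun c : G.ConnectedComponent => c.supp.ncard) (Set.toFinite _).bddAbove c
    exact_mod_cast this

theorem maxComponentSize_le_size [Fintype V] : maxComponentSize V G ≤ size V G := by
  rcases isEmpty_or_nonempty G.ConnectedComponent with h | h
  · simp [maxComponentSize]
  · exact ciSup_le fun c => (Set.ncard_le_card _).trans Nat.card_eq_fintype_card.le

end Elimination

/-! ### Random deletions -/

section RandomDeletion

variable {V : Type} {G : SimpleGraph V} {S : Set V} {ε : ℚ} {k : ℕ}

open Classical in
/-- A condition on one coordinate has the same probability in the product as in the factor. -/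
theorem card_filter_pi {ι : Type*} [Fintype ι] [DecidableEq ι] {Ω : ι → Type*}
    [∀ i, Fintype (Ω i)] (i : ι) (p : Ω i → Prop) :
    (Finset.univ.filter fun ω : ∀ i, Ω i => p (ω i)).card * Fintype.card (Ω i) =
      (Finset.univ.filter p).card * Fintype.card (∀ i, Ω i) := by
  have h1 : (Finset.univ.filter fun ω : ∀ i, Ω i => p (ω i)).card =
      (Finset.univ.filter p).card * Fintype.card (∀ j : {j // j ≠ i}, Ω j) := by
    rw [← Fintype.card_subtype, ← Fintype.card_subtype, ← Fintype.card_prod]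
    refine Fintype.card_congr ?_
    refine ((Equiv.piSplitAt i Ω).subtypeEquiv (q := fun x => p x.1) fun ω => by simp).trans ?_
    exact {
      toFun := fun x => (⟨x.1.1, x.2⟩, x.1.2)
      invFun := fun x => ⟨(x.1.1, x.2), x.1.2⟩
      left_inv := fun _ => rfl
      right_inv := fun _ => rfl }
  rw [h1, Fintype.card_congr (Equiv.piSplitAt i Ω), Fintype.card_prod]
  ring

open Classical in
theorem card_filter_pi_le {ι : Type*} [Fintype ι] [DecidableEq ι] {Ω : ι → Type*}
    [∀ i, Fintype (Ω i)] [∀ i, Nonempty (Ω i)] (i : ι) (p : Ω i → Prop)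
    (h : ((Finset.univ.filter p).card : ℚ) ≤ ε * Fintype.card (Ω i)) :
    ((Finset.univ.filter fun ω : ∀ i, Ω i => p (ω i)).card : ℚ) ≤
      ε * Fintype.card (∀ i, Ω i) := by
  have h1 : ((Finset.univ.filter fun ω : ∀ i, Ω i => p (ω i)).card : ℚ) * Fintype.card (Ω i) =
      (Finset.univ.filter p).card * Fintype.card (∀ i, Ω i) := by
    exact_mod_cast card_filter_pi i p
  have h2 : (0 : ℚ) < Fintype.card (Ω i) := by exact_mod_cast Fintype.card_pos
  refine le_of_mul_le_mul_right ?_ h2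
  rw [h1]
  calc ((Finset.univ.filter p).card : ℚ) * Fintype.card (∀ i, Ω i)
      ≤ ε * Fintype.card (Ω i) * Fintype.card (∀ i, Ω i) := by gcongr
    _ = ε * Fintype.card (∀ i, Ω i) * Fintype.card (Ω i) := by ring

open Classical in
/-- `RandomElim G ε k S`: a random set of vertices, drawn uniformly from a finite list, hits every
vertex with probability at most `ε` and leaves of `S` a set of treedepth at most `k`. -/
def RandomElim (G : SimpleGraph V) (ε : ℚ) (k : ℕ) (S : Set V) : Prop :=
  ∃ (Ω : Type) (_ : Fintype Ω) (_ : Nonempty Ω) (X : Ω → Set V),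
    (∀ v, ((Finset.univ.filter fun ω => v ∈ X ω).card : ℚ) ≤ ε * Fintype.card Ω) ∧
    ∀ ω, Elim G k (S \ X ω)

open Classical in
theorem RandomElim.comps [Finite V] (hε : 0 ≤ ε)
    (h : ∀ v ∈ S, RandomElim G ε k (comp G S v)) : RandomElim G ε k S := by
  have := Fintype.ofFinite V
  have h' : ∀ v, ∃ (Ω : Type) (_ : Fintype Ω) (_ : Nonempty Ω) (X : Ω → Set V),
      (∀ w, ((Finset.univ.filter fun ω => w ∈ X ω).card : ℚ) ≤ ε * Fintype.card Ω) ∧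
      (v ∈ S → ∀ ω, Elim G k (comp G S v \ X ω)) := by
    intro v
    by_cases hv : v ∈ S
    · obtain ⟨Ω, h1, h2, X, h3, h4⟩ := h v hv
      exact ⟨Ω, h1, h2, X, h3, fun _ => h4⟩
    · exact ⟨Unit, inferInstance, inferInstance, fun _ => ∅, fun w => by simpa using hε,
        fun h => absurd h hv⟩
  choose Ω hΩ hΩ' X hX hXS using h'
  -- `rep` selects one vertex of each component, and the components draw independently.
  let rep : V → V := fun v => if h : (comp G S v).Nonempty then h.some else v
  have hrep : ∀ v ∈ S, rep v ∈ comp G S v := by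
    intro v hv
    have hne : (comp G S v).Nonempty := ⟨v, mem_comp_self hv⟩
    simp only [rep, dif_pos hne]
    exact hne.some_mem
  have hrep' : ∀ v ∈ S, ∀ w ∈ comp G S v, rep v = rep w := by
    intro v hv w hw
    have h1 := comp_eq_of_mem hw
    have hne : (comp G S v).Nonempty := ⟨v, mem_comp_self hv⟩
    have hne' : (comp G S w).Nonempty := h1 ▸ hne
    simp only [rep, dif_pos hne, dif_pos hne']
    congr 1
    exact h1.symm
  refine ⟨∀ v, Ω v, inferInstance, inferInstance, fun ω => {w | w ∈ X (rep w) (ω (rep w))},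
    fun w => ?_, fun ω => ?_⟩
  · exact card_filter_pi_le (rep w) (fun x => w ∈ X (rep w) x) (hX _ _)
  · refine .of_label rep (fun a ha b hb hab => ?_) fun r => ?_
    · exact hrep' a ha.1 b (mem_comp_of_adj (mem_comp_self ha.1) hab hb.1)
    · by_cases hr : r ∈ S
      · refine (hXS r hr (ω r)).subset fun w hw => ?_
        have hw2 : rep w = r := hw.2
        refine ⟨?_, fun h => hw.1.2 ?_⟩
        · rw [← hw2, comp_eq_of_mem (hrep w hw.1.1)]
          exact mem_comp_self hw.1.1
        · rw [← hw2] at h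
          exact h
      · have : {v | v ∈ S \ {w | w ∈ X (rep w) (ω (rep w))} ∧ rep v = r} = ∅ := by
          ext w
          simp only [Set.mem_ofPred_eq, Set.mem_empty_iff_false, iff_false]
          rintro ⟨hw, rfl⟩
          exact hr (hrep w hw.1).1
        rw [this]
        exact .empty k

open Classical in
/-- A uniformly random residue `i` is drawn together with independent choices for all the residues,
of which only the one for `i` is used. A vertex has residue `i` with probability `1 / m`. -/
theorem RandomElim.layer {m : ℕ} (hm : 0 < m) (lam : V → ℕ)
    (h : ∀ i < m, RandomElim G ε k (S \ {v | lam v % m = i})) :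
    RandomElim G (ε + 1 / m) k S := by
  have h' : ∀ i : Fin m, RandomElim G ε k (S \ {v | lam v % m = i}) := fun i => h i i.2
  choose Ω hΩ hΩ' X hX hXS using h'
  have : Nonempty (Fin m) := ⟨⟨0, hm⟩⟩
  refine ⟨Fin m × ∀ i, Ω i, inferInstance, inferInstance,
    fun p => {v | lam v % m = p.1} ∪ X p.1 (p.2 p.1), fun v => ?_, fun p => ?_⟩
  · have hm' : (m : ℚ) ≠ 0 := by positivity
    set N : ℚ := (Fintype.card (∀ i, Ω i) : ℚ) with hN
    have h1 : ∀ i : Fin m, ((Finset.univ.filter fun ω : ∀ i, Ω i =>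
        v ∈ ({v | lam v % m = i} ∪ X i (ω i) : Set V)).card : ℚ) ≤
        (if i = ⟨lam v % m, Nat.mod_lt _ hm⟩ then N else 0) + ε * N := by
      intro i
      have h2 := card_filter_pi_le i (fun x => v ∈ X i x) (hX i v)
      have h0 : 0 ≤ ε * N := (Nat.cast_nonneg _).trans h2
      split_ifs with hi
      · have : ((Finset.univ.filter fun ω : ∀ i, Ω i =>
            v ∈ ({v | lam v % m = i} ∪ X i (ω i) : Set V)).card : ℚ) ≤ N := by
          rw [hN]
          exact_mod_cast Finset.card_le_univ _
        linarith
      · rw [zero_add]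
        refine le_trans ?_ h2
        norm_cast
        refine Finset.card_le_card fun ω hω => ?_
        rw [Finset.mem_filter] at hω ⊢
        refine ⟨hω.1, hω.2.resolve_left fun h3 => hi ?_⟩
        exact Fin.ext (Eq.symm h3)
    have hcard : (Fintype.card (Fin m × ∀ i, Ω i) : ℚ) = m * N := by
      rw [Fintype.card_prod, Fintype.card_fin]
      push_cast [hN]
      ring
    have hsum : (Finset.univ.filter fun p : Fin m × ∀ i, Ω i =>
        v ∈ ({v | lam v % m = p.1} ∪ X p.1 (p.2 p.1) : Set V)).card =
        ∑ i : Fin m, (Finset.univ.filter fun ω : ∀ i, Ω i =>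
          v ∈ ({v | lam v % m = i} ∪ X i (ω i) : Set V)).card := by
      simp_rw [Finset.card_filter]
      rw [Fintype.sum_prod_type]
    suffices ((∑ i : Fin m, (Finset.univ.filter fun ω : ∀ i, Ω i =>
          v ∈ ({v | lam v % m = i} ∪ X i (ω i) : Set V)).card : ℕ) : ℚ) ≤
        (ε + 1 / m) * Fintype.card (Fin m × ∀ i, Ω i) by
      rw [← hsum] at this
      convert this
    rw [hcard]
    push_cast
    refine (Finset.sum_le_sum fun i _ => h1 i).trans (le_of_eq ?_)
    rw [Finset.sum_add_distrib, Finset.sum_ite_eq' Finset.univ, if_pos (Finset.mem_univ _),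
      Finset.sum_const, Finset.card_univ, Fintype.card_fin, nsmul_eq_mul]
    field_simp
    ring
  · rw [← Set.sdiff_sdiff]
    exact hXS _ _

/-- A reduction strategy is played with random residues; the vertices it deletes by choice are not
part of the random set, but each of them adds one to the treedepth. -/
theorem Red.randomElim [Finite V] (h : Red G (· = ∅) ε k S) : RandomElim G ε k S := by
  classical
  induction h with
  | @base S hS =>
    refine ⟨Unit, inferInstance, inferInstance, fun _ => ∅, fun v => by simp, fun _ => ?_⟩
    rw [hS, Set.empty_sdiff]
    exact .empty 0
  | comps hε _ ih => exact .comps hε ih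
  | @del ε k S v _ ih =>
    obtain ⟨Ω, h1, h2, X, h3, h4⟩ := ih
    refine ⟨Ω, h1, h2, X, h3, fun ω => .of_sdiff v ?_⟩
    rw [Set.sdiff_sdiff_comm]
    exact h4 ω
  | layer m lam hm _ ih => exact .layer hm lam ih
  | @mono ε δ k l S h5 h6 _ ih =>
    obtain ⟨Ω, h1, h2, X, h3, h4⟩ := ih
    refine ⟨Ω, h1, h2, X, fun v => (h3 v).trans ?_, fun ω => (h4 ω).mono h6⟩
    gcongr

end RandomDeletion

/-! ### The opt-distance -/

section OptDist

variable {σ : Signature} {A B C : ValuedStructure σ}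

theorem logDist_triangle (a b c : ℚ≥0) : logDist a c ≤ logDist a b + logDist b c := by
  by_cases ha : a = 0 <;> by_cases hb : b = 0 <;> by_cases hc : c = 0 <;> simp [logDist, ha, hb, hc]
  rw [← ENNReal.ofReal_add (abs_nonneg _) (abs_nonneg _)]
  exact ENNReal.ofReal_le_ofReal (abs_sub_le _ _ _)

theorem optDist_triangle (A B C : ValuedStructure σ) :
    optDist A C ≤ optDist A B + optDist B C :=
  iSup_le fun D => (logDist_triangle _ (opt B D) _).trans
    (add_le_add (le_iSup (fun D => logDist (opt A D) (opt B D)) D)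
      (le_iSup (fun D => logDist (opt B D) (opt C D)) D))

theorem mapVal_le_opt (h : A.Dom → B.Dom) : mapVal A B h ≤ opt A B := by
  classical
  unfold opt
  convert Finset.le_sup' (mapVal A B) (Finset.mem_univ h)

theorem exists_mapVal_eq_opt (A B : ValuedStructure σ) : ∃ h, mapVal A B h = opt A B := by
  classical
  obtain ⟨h, _, hh⟩ := Finset.exists_mem_eq_sup' (Finset.univ_nonempty (α := A.Dom → B.Dom))
    (mapVal A B)
  refine ⟨h, hh.symm.trans ?_⟩
  unfold opt
  congr!

theorem logDist_le {a b : ℚ≥0} {δ : ℚ} (hδ : 0 ≤ δ) (hδ' : δ ≤ 1 / 2)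
    (h1 : (1 - δ) * a ≤ b) (h2 : (b : ℚ) ≤ (1 + δ) * a) :
    logDist a b ≤ ENNReal.ofReal (2 * δ) := by
  have hδr : (0 : ℝ) ≤ δ := by exact_mod_cast hδ
  have hδr' : (δ : ℝ) ≤ 1 / 2 := by
    have : ((δ : ℚ) : ℝ) ≤ ((1 / 2 : ℚ) : ℝ) := by exact_mod_cast hδ'
    simpa using this
  have h1r : (1 - (δ : ℝ)) * (a : ℝ) ≤ (b : ℝ) := by exact_mod_cast h1
  have h2r : (b : ℝ) ≤ (1 + (δ : ℝ)) * (a : ℝ) := by exact_mod_cast h2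
  rcases eq_or_ne a 0 with rfl | ha
  · have hb : b = 0 := by
      have : (b : ℚ) ≤ 0 := by simpa using h2
      exact le_antisymm (by exact_mod_cast this) (zero_le)
    simp [logDist, hb]
  · have ha' : (0 : ℝ) < a := by exact_mod_cast pos_iff_ne_zero.2 ha
    have hb' : (0 : ℝ) < b := lt_of_lt_of_le (by nlinarith) h1r
    have hb : b ≠ 0 := by
      rintro rfl
      simp at hb'
    simp only [logDist, ha, hb, and_self, or_self, if_false]
    refine ENNReal.ofReal_le_ofReal ?_
    rw [← Real.log_div ha'.ne' hb'.ne', abs_le]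
    constructor
    · have h3 : (b : ℝ) / a ≤ 1 + δ := by
        rwa [div_le_iff₀ ha']
      have h4 := Real.log_le_sub_one_of_pos (div_pos hb' ha')
      rw [← inv_div, Real.log_inv]
      linarith
    · have h3 : (a : ℝ) / b ≤ 1 + 2 * δ := by
        rw [div_le_iff₀ hb']
        nlinarith
      have h4 := Real.log_le_sub_one_of_pos (div_pos ha' hb')
      linarith

theorem optDist_le {δ : ℚ} (hδ : 0 ≤ δ) (hδ' : δ ≤ 1 / 2)
    (h1 : ∀ C, (1 - δ) * opt A C ≤ opt B C) (h2 : ∀ C, (opt B C : ℚ) ≤ (1 + δ) * opt A C) :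
    optDist A B ≤ ENNReal.ofReal (2 * δ) :=
  iSup_le fun C => logDist_le hδ hδ' (h1 C) (h2 C)

end OptDist

/-! ### Structures given by lists of weighted tuples -/

section OfTuples

variable {σ : Signature} {D : Type} [Fintype D] [Nonempty D] {I : σ.Symb → Type}
  [∀ f, Fintype (I f)]

open Classical in
/-- The structure on `D` in which the value of a tuple under `f` is the total weight of its
occurrences in a list of tuples indexed by `I f`. -/
noncomputable def ofTuples (w : ∀ f, I f → ℚ≥0) (x : ∀ f, I f → Fin (σ.arity f) → D) :
    ValuedStructure σ where
  Dom := D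
  val f y := ∑ e, if x f e = y then w f e else 0

theorem mapVal_ofTuples (w : ∀ f, I f → ℚ≥0) (x : ∀ f, I f → Fin (σ.arity f) → D)
    (C : ValuedStructure σ) (h : D → C.Dom) :
    mapVal (ofTuples w x) C h = ∑ f, ∑ e, w f e * C.val f (h ∘ x f e) := by
  classical
  have key : ∀ f, ∑ y : Fin (σ.arity f) → D,
      (∑ e, if x f e = y then w f e else 0) * C.val f (h ∘ y) =
        ∑ e, w f e * C.val f (h ∘ x f e) := by
    intro f
    simp_rw [Finset.sum_mul, ite_mul, zero_mul]
    rw [Finset.sum_comm]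
    exact Finset.sum_congr rfl fun e _ => by
      rw [Finset.sum_ite_eq, if_pos (Finset.mem_univ _)]
  refine Finset.sum_congr rfl fun f _ => (Eq.trans ?_ (key f))
  rfl

theorem exists_of_gaifman_ofTuples_adj {w : ∀ f, I f → ℚ≥0}
    {x : ∀ f, I f → Fin (σ.arity f) → D} {u v : D} (h : (gaifman (ofTuples w x)).Adj u v) :
    u ≠ v ∧ ∃ f e, 0 < w f e ∧ u ∈ Set.range (x f e) ∧ v ∈ Set.range (x f e) := by
  classical
  obtain ⟨hne, f, y, hy, hu, hv⟩ := h
  refine ⟨hne, f, ?_⟩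
  obtain ⟨e, _, he⟩ := Finset.exists_ne_zero_of_sum_ne_zero hy.ne'
  split_ifs at he with h1
  · exact ⟨e, pos_iff_ne_zero.2 he, h1 ▸ hu, h1 ▸ hv⟩
  · exact absurd rfl he

end OfTuples

/-! ### From the Hadwiger number to the treedepth -/

section Hadwiger

variable {σ : Signature}

theorem isMinor_card_le {V : Type} [Fintype V] {G : SimpleGraph V} {k : ℕ}
    (h : IsMinor (⊤ : SimpleGraph (Fin k)) G) : k ≤ Fintype.card V := by
  obtain ⟨br, hconn, hdisj, _⟩ := h
  have hne : ∀ x, ∃ v, v ∈ br x := fun x => by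
    obtain ⟨v⟩ := (hconn x).nonempty
    exact ⟨v, v.2⟩
  choose f hf using hne
  have hinj : Function.Injective f := fun x y hxy => by
    by_contra hne
    exact Set.disjoint_left.1 (hdisj x y hne) (hf x) (hxy ▸ hf y)
  simpa using Fintype.card_le_of_injective f hinj

theorem not_isMinor_of_hadwiger_le {V : Type} [Fintype V] {G : SimpleGraph V} {k : ℕ}
    (h : hadwiger V G ≤ k) : ¬ IsMinor (⊤ : SimpleGraph (Fin (k + 1))) G := fun hm => by
  have hbdd : BddAbove {k | IsMinor (⊤ : SimpleGraph (Fin k)) G} :=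
    ⟨Fintype.card V, fun _ hk => isMinor_card_le hk⟩
  have : k + 1 ≤ hadwiger V G := le_csSup hbdd hm
  omega

theorem isMinor_of_clique {V : Type} {G : SimpleGraph V} {s : Finset V}
    (hs : ∀ a ∈ s, ∀ b ∈ s, a ≠ b → G.Adj a b) {k : ℕ} (hk : k ≤ s.card) :
    IsMinor (⊤ : SimpleGraph (Fin k)) G := by
  obtain ⟨s', hs', rfl⟩ := Finset.exists_subset_card_eq hk
  let e := s'.equivFin.symm
  refine ⟨fun i => {(e i : V)}, fun i => ?_, fun i j hij => ?_, fun i j hij => ?_⟩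
  · exact ConnIn.connected (fun a ha b hb => by
      rw [Set.mem_singleton_iff.1 ha, Set.mem_singleton_iff.1 hb]) ⟨_, rfl⟩
  · rw [Set.disjoint_singleton]
    exact fun h => hij (e.injective (Subtype.ext h))
  · exact ⟨_, rfl, _, rfl, hs _ (hs' (e i).2) _ (hs' (e j).2)
      fun h => hij.ne (e.injective (Subtype.ext h))⟩

open Classical in
/-- A random deletion, averaged: the disjoint union, over all the sets `X ω`, of the copies of `A`
from which the tuples meeting `X ω` are removed, scaled down by the number of copies. -/
noncomputable def deletionAverage (A : ValuedStructure σ) {Ω : Type} [Fintype Ω] [Nonempty Ω]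
    (X : Ω → Set A.Dom) : ValuedStructure σ :=
  ofTuples (D := Ω × A.Dom) (I := fun f => Ω × (Fin (σ.arity f) → A.Dom))
    (fun f e => if ∃ i, e.2 i ∈ X e.1 then 0 else A.val f e.2 / Fintype.card Ω)
    (fun _ e i => (e.1, e.2 i))

open Classical in
theorem mapVal_deletionAverage (A C : ValuedStructure σ) {Ω : Type} [Fintype Ω] [Nonempty Ω]
    (X : Ω → Set A.Dom) (h : Ω × A.Dom → C.Dom) :
    mapVal (deletionAverage A X) C h = ∑ f, ∑ e : Ω × (Fin (σ.arity f) → A.Dom),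
      (if ∃ i, e.2 i ∈ X e.1 then 0 else A.val f e.2 / Fintype.card Ω) *
        C.val f (fun i => h (e.1, e.2 i)) :=
  mapVal_ofTuples _ _ C h

theorem elim_gaifman_deletionAverage {A : ValuedStructure σ} {Ω : Type} [Fintype Ω] [Nonempty Ω]
    {X : Ω → Set A.Dom} {k : ℕ} (h : ∀ ω, Elim (gaifman A) k (Set.univ \ X ω)) :
    Elim (gaifman (deletionAverage A X)) (k + 1) Set.univ := by
  have hadj : ∀ p q : Ω × A.Dom, (gaifman (deletionAverage A X)).Adj p q →
      p.1 = q.1 ∧ p.2 ∉ X p.1 ∧ q.2 ∉ X q.1 ∧ (gaifman A).Adj p.2 q.2 := by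
    intro p q hpq
    obtain ⟨hne, f, e, he, ⟨i, hi⟩, ⟨j, hj⟩⟩ := exists_of_gaifman_ofTuples_adj hpq
    split_ifs at he with hX
    · exact absurd rfl he.ne
    · push Not at hX
      subst hi hj
      refine ⟨rfl, hX i, hX j, ?_, f, e.2, ?_, ⟨i, rfl⟩, ⟨j, rfl⟩⟩
      · exact fun h => hne (Prod.ext rfl h)
      · by_contra h0
        rw [not_lt, nonpos_iff_eq_zero] at h0
        rw [h0, zero_div] at he
        exact absurd rfl he.ne
  have : Finite (deletionAverage A X).Dom := inferInstanceAs (Finite (Ω × A.Dom))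
  refine .of_label (ι := Ω) (fun p : Ω × A.Dom => p.1) (fun a _ b _ hab => (hadj a b hab).1)
    fun ω => ?_
  refine .of_label (ι := Prop) (fun p : Ω × A.Dom => p.2 ∈ X p.1)
    (fun a _ b _ hab => propext ?_) fun q => ?_
  · obtain ⟨_, h1, h2, _⟩ := hadj a b hab
    exact ⟨fun h => absurd h h1, fun h => absurd h h2⟩
  · by_cases hq : q
    · refine (elim_one_of_not_adj fun a ha b _ hab => ?_).mono (Nat.le_add_left 1 k)
      exact (hadj a b hab).2.1 (ha.2 ▸ hq)
    · refine ((h ω).comap (fun p : Ω × A.Dom => p.2) ?_ ?_ ?_).mono (Nat.le_succ k)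
      · rintro a ⟨⟨_, ha⟩, _⟩ b ⟨⟨_, hb⟩, _⟩ hab
        exact Prod.ext (ha.trans hb.symm) hab
      · rintro a ⟨⟨_, rfl⟩, rfl⟩
        exact ⟨trivial, hq⟩
      · exact fun a _ b _ hab => (hadj a b hab).2.2.2

theorem opt_deletionAverage_le (A C : ValuedStructure σ) {Ω : Type} [Fintype Ω] [Nonempty Ω]
    (X : Ω → Set A.Dom) : opt (deletionAverage A X) C ≤ opt A C := by
  classical
  obtain ⟨h, hh⟩ := exists_mapVal_eq_opt (deletionAverage A X) C
  have hΩ : (Fintype.card Ω : ℚ≥0) ≠ 0 := by exact_mod_cast Fintype.card_ne_zero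
  rw [← hh]
  refine (mapVal_deletionAverage A C X h).trans_le ?_
  calc _ ≤ ∑ f, ∑ e : Ω × (Fin (σ.arity f) → A.Dom),
        A.val f e.2 * C.val f (fun i => h (e.1, e.2 i)) / Fintype.card Ω := by
        refine Finset.sum_le_sum fun f _ => Finset.sum_le_sum fun e _ => ?_
        split_ifs
        · rw [zero_mul]
          exact zero_le
        · rw [div_mul_eq_mul_div]
    _ = (∑ ω : Ω, mapVal A C (fun a => h (ω, a))) / Fintype.card Ω := by
        simp_rw [Fintype.sum_prod_type, ← Finset.sum_div]
        rw [Finset.sum_comm]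
        rfl
    _ ≤ (∑ ω : Ω, opt A C) / Fintype.card Ω := by
        gcongr
        exact mapVal_le_opt _
    _ = opt A C := by
        rw [Finset.sum_const, Finset.card_univ, nsmul_eq_mul]
        field_simp

theorem le_opt_deletionAverage (A C : ValuedStructure σ) {Ω : Type} [Fintype Ω] [Nonempty Ω]
    (X : Ω → Set A.Dom) {δ : ℚ}
    (hX : ∀ f (y : Fin (σ.arity f) → A.Dom), 0 < A.val f y →
      (Nat.card {ω | ∃ i, y i ∈ X ω} : ℚ) ≤ δ * Fintype.card Ω) :
    (1 - δ) * opt A C ≤ opt (deletionAverage A X) C := by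
  classical
  obtain ⟨h, hh⟩ := exists_mapVal_eq_opt A C
  have hΩ : (0 : ℚ) < Fintype.card Ω := by exact_mod_cast Fintype.card_pos
  have h1 := mapVal_le_opt (A := deletionAverage A X) (B := C) (fun p : Ω × A.Dom => h p.2)
  have h2 : ((mapVal (deletionAverage A X) C (fun p : Ω × A.Dom => h p.2) : ℚ≥0) : ℚ) ≤
    opt (deletionAverage A X) C := by exact_mod_cast h1
  refine le_trans ?_ h2
  rw [← hh, mapVal_deletionAverage]
  unfold mapVal
  push_cast
  simp_rw [Finset.mul_sum]
  refine Finset.sum_le_sum fun f _ => ?_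
  rw [Fintype.sum_prod_type, Finset.sum_comm]
  refine Finset.sum_le_sum fun y _ => ?_
  rcases eq_or_lt_of_le (zero_le (a := A.val f y)) with h0 | h0
  · simp [← h0]
  have hterm : ∀ ω : Ω, (((if ∃ i, y i ∈ X ω then 0 else A.val f y / Fintype.card Ω : ℚ≥0)) : ℚ) *
      C.val f (h ∘ y) = (A.val f y * C.val f (h ∘ y) / Fintype.card Ω : ℚ) *
        (1 - if ∃ i, y i ∈ X ω then 1 else 0) := by
    intro ω
    split_ifs
    · simp
    · push_cast
      ring
  refine le_trans ?_ (le_of_eq (Finset.sum_congr rfl fun ω _ => (hterm ω).symm))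
  rw [← Finset.mul_sum, Finset.sum_sub_distrib, Finset.sum_boole, Finset.sum_const,
    Finset.card_univ, nsmul_eq_mul, mul_one]
  have h3 := hX f y h0
  have h4 : Nat.card {ω | ∃ i, y i ∈ X ω} = (Finset.univ.filter fun ω => ∃ i, y i ∈ X ω).card := by
    rw [← Fintype.card_subtype, ← Nat.card_eq_fintype_card]
    rfl
  rw [h4] at h3
  have h5 : (0 : ℚ) ≤ A.val f y * C.val f (h ∘ y) / Fintype.card Ω := by positivity
  calc (1 - δ) * (A.val f y * C.val f (h ∘ y) : ℚ)
      = (A.val f y * C.val f (h ∘ y) / Fintype.card Ω : ℚ) *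
        (Fintype.card Ω - δ * Fintype.card Ω) := by field_simp
    _ ≤ _ := by gcongr

/-- A random deletion that hits every vertex with small probability hits every tuple of positive
value with small probability, as the entries of such a tuple form a clique. -/
theorem card_hits_le {A : ValuedStructure σ} {k : ℕ}
    (hA : ¬ IsMinor (⊤ : SimpleGraph (Fin (k + 1))) (gaifman A)) {Ω : Type} [Fintype Ω]
    {X : Ω → Set A.Dom} {ε : ℚ} (hε : 0 ≤ ε)
    (hX : ∀ v, (Nat.card {ω | v ∈ X ω} : ℚ) ≤ ε * Fintype.card Ω) {f : σ.Symb}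
    {y : Fin (σ.arity f) → A.Dom} (hy : 0 < A.val f y) :
    (Nat.card {ω | ∃ i, y i ∈ X ω} : ℚ) ≤ k * ε * Fintype.card Ω := by
  classical
  have hcard : (Finset.univ.image y).card ≤ k := by
    by_contra! hlt
    refine hA (isMinor_of_clique (s := Finset.univ.image y) ?_ hlt)
    intro a ha b hb hab
    exact ⟨hab, f, y, hy, by simpa using ha, by simpa using hb⟩
  have hsub : {ω | ∃ i, y i ∈ X ω} = ⋃ v ∈ Finset.univ.image y, {ω | v ∈ X ω} := by
    ext ω
    simp
  have h1 : {ω | ∃ i, y i ∈ X ω}.ncard ≤ ∑ v ∈ Finset.univ.image y, {ω | v ∈ X ω}.ncard := by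
    rw [hsub]
    exact Finset.set_ncard_biUnion_le _ _
  have h2 : (({ω | ∃ i, y i ∈ X ω}.ncard : ℕ) : ℚ) ≤
      ∑ v ∈ Finset.univ.image y, ({ω | v ∈ X ω}.ncard : ℚ) := by exact_mod_cast h1
  refine h2.trans ((Finset.sum_le_sum fun v _ => hX v).trans ?_)
  rw [Finset.sum_const, nsmul_eq_mul, mul_assoc]
  have : ((Finset.univ.image y).card : ℚ) ≤ k := by exact_mod_cast hcard
  gcongr

theorem exists_pos_rat_two_mul_le {ε : ℝ} (hε : 0 < ε) :
    ∃ δ : ℚ, 0 < δ ∧ δ ≤ 1 / 2 ∧ 2 * (δ : ℝ) ≤ ε := by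
  obtain ⟨δ, hδ0, hδ⟩ : ∃ δ : ℚ, (0 : ℝ) < δ ∧ (δ : ℝ) < min (ε / 2) (1 / 2) :=
    exists_rat_btwn (by positivity)
  refine ⟨δ, by exact_mod_cast hδ0, ?_, ?_⟩
  · have : (δ : ℝ) ≤ ((1 / 2 : ℚ) : ℝ) := by
      push_cast
      exact (hδ.trans_le (min_le_right _ _)).le
    exact_mod_cast this
  · have := hδ.trans_le (min_le_left _ _)
    linarith

theorem exists_treedepth_optDist_le (k : ℕ) (ε : ℝ) (hε : 0 < ε) :
    ∃ d : ℕ, ∀ (σ : Signature) (A : ValuedStructure σ), hadwiger A.Dom (gaifman A) ≤ k →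
      ∃ B : ValuedStructure σ, treedepth B.Dom (gaifman B) ≤ d ∧
        optDist A B ≤ ENNReal.ofReal ε := by
  classical
  obtain ⟨δ, hδ0, hδ2, hδε⟩ := exists_pos_rat_two_mul_le hε
  obtain ⟨d, hd⟩ := exists_red_empty k (δ / (k + 1)) (by positivity)
  refine ⟨d + 1, fun σ A hA => ?_⟩
  have hm := not_isMinor_of_hadwiger_le hA
  obtain ⟨Ω, _, _, X, hX, hel⟩ := (hd A.Dom (gaifman A) hm).randomElim
  refine ⟨deletionAverage A X, treedepth_le_iff_elim.2 (elim_gaifman_deletionAverage hel),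
    (optDist_le hδ0.le hδ2 (fun C => ?_) fun C => ?_).trans (ENNReal.ofReal_le_ofReal hδε)⟩
  · refine le_opt_deletionAverage A C X fun f y hy => ?_
    refine (card_hits_le hm (ε := δ / (k + 1)) (by positivity) (fun v => ?_) hy).trans ?_
    · refine le_trans (le_of_eq ?_) (hX v)
      rw [← Fintype.card_subtype, ← Nat.card_eq_fintype_card]
      rfl
    · gcongr
      rw [mul_div_assoc', div_le_iff₀ (by positivity)]
      nlinarith
  · have h1 : (opt (deletionAverage A X) C : ℚ) ≤ opt A C := by
      exact_mod_cast opt_deletionAverage_le A C X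
    have h2 : (0 : ℚ) ≤ opt A C := by positivity
    nlinarith

theorem IsPliable.of_exists_optDist_le {p q : GraphParameter} {𝒜 : StructureClass}
    (h : IsPliable p 𝒜) (hpq : ∀ (k : ℕ) (ε : ℝ), 0 < ε → ∃ d : ℕ, ∀ (σ : Signature),
      (𝒜 σ).Nonempty → ∀ A : ValuedStructure σ, p A.Dom (gaifman A) ≤ k →
        ∃ B : ValuedStructure σ, q B.Dom (gaifman B) ≤ d ∧ optDist A B ≤ ENNReal.ofReal ε) :
    IsPliable q 𝒜 := by
  intro ε hε
  obtain ⟨k, hk⟩ := h (ε / 2) (by positivity)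
  obtain ⟨d, hd⟩ := hpq k (ε / 2) (by positivity)
  refine ⟨d, fun σ A hA => ?_⟩
  obtain ⟨B, hB, hAB⟩ := hk σ A hA
  obtain ⟨B', hB', hBB⟩ := hd σ ⟨A, hA⟩ B hB
  refine ⟨B', hB', (optDist_triangle A B B').trans ((add_le_add hAB hBB).trans ?_)⟩
  rw [← ENNReal.ofReal_add (by positivity) (by positivity), add_halves]

theorem IsPliable.treedepth_of_hadwiger {𝒜 : StructureClass} (h : IsPliable hadwiger 𝒜) :
    IsPliable treedepth 𝒜 :=
  h.of_exists_optDist_le fun k ε hε => by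
    obtain ⟨d, hd⟩ := exists_treedepth_optDist_le k ε hε
    exact ⟨d, fun σ _ => hd σ⟩

theorem IsPliable.of_le {p q : GraphParameter} {𝒜 : StructureClass} (h : IsPliable p 𝒜) (c : ℕ)
    (hpq : ∀ (V : Type) [Fintype V] (G : SimpleGraph V), q V G ≤ p V G + c) : IsPliable q 𝒜 := by
  intro ε hε
  obtain ⟨k, hk⟩ := h ε hε
  refine ⟨k + c, fun σ A hA => ?_⟩
  obtain ⟨B, hB, hAB⟩ := hk σ A hA
  exact ⟨B, (hpq _ _).trans (by omega), hAB⟩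

end Hadwiger

/-! ### Treewidth is at most treedepth -/

section PathDecomposition

variable {V : Type} {G : SimpleGraph V} {S : Set V} {n : ℕ}

/-- The bags `bag 0, …, bag (N - 1)` form a path decomposition of the subgraph of `G` induced on
`S`, with bags of size at most `n`. -/
structure IsPathDecomposition (G : SimpleGraph V) (S : Set V) (n N : ℕ) (bag : ℕ → Finset V) :
    Prop where
  subset : ∀ i < N, (bag i : Set V) ⊆ S
  exists_mem : ∀ v ∈ S, ∃ i < N, v ∈ bag i
  exists_edge : ∀ u ∈ S, ∀ v ∈ S, G.Adj u v → ∃ i < N, u ∈ bag i ∧ v ∈ bag i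
  convex : ∀ v i j l, i ≤ j → j ≤ l → l < N → v ∈ bag i → v ∈ bag l → v ∈ bag j
  card_le : ∀ i < N, (bag i).card ≤ n

/-- A deleted vertex is added to all the bags and forms one further bag by itself, and the
decompositions of parts without edges between them are lined up one after the other. -/
theorem Elim.exists_isPathDecomposition (h : Elim G n S) :
    ∃ N bag, IsPathDecomposition G S n N bag := by
  classical
  induction h with
  | empty n => exact ⟨0, fun _ => ∅, by simp, by simp, by simp, by simp, by simp⟩
  | @vertex n S v hv _ ih =>
    obtain ⟨N, bag, h1, h2, h3, h4, h5⟩ := ih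
    have hvb : ∀ i < N, v ∉ bag i := fun i hi hvi => (h1 i hi hvi).2 rfl
    refine ⟨N + 1, fun i => if i < N then insert v (bag i) else {v}, ?_, ?_, ?_, ?_, ?_⟩
    · intro i hi
      split_ifs with hiN
      · rw [Finset.coe_insert]
        exact Set.insert_subset hv ((h1 i hiN).trans Set.sdiff_subset)
      · simpa using hv
    · intro w hw
      by_cases hwv : w = v
      · exact ⟨N, by omega, by simp [hwv]⟩
      · obtain ⟨i, hi, hwi⟩ := h2 w ⟨hw, hwv⟩
        exact ⟨i, by omega, by simp [hi, hwi]⟩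
    · intro a ha b hb hab
      by_cases hav : a = v
      · subst hav
        obtain ⟨i, hi, hbi⟩ := h2 b ⟨hb, hab.ne'⟩
        exact ⟨i, by omega, by simp [hi], by simp [hi, hbi]⟩
      · by_cases hbv : b = v
        · subst hbv
          obtain ⟨i, hi, hai⟩ := h2 a ⟨ha, hav⟩
          exact ⟨i, by omega, by simp [hi, hai], by simp [hi]⟩
        · obtain ⟨i, hi, hai, hbi⟩ := h3 a ⟨ha, hav⟩ b ⟨hb, hbv⟩ hab
          exact ⟨i, by omega, by simp [hi, hai], by simp [hi, hbi]⟩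
    · intro w i j l hij hjl hl hwi hwl
      by_cases hwv : w = v
      · split_ifs <;> simp [hwv]
      · have hlN : l < N := by
          by_contra hlN
          rw [if_neg hlN] at hwl
          exact hwv (by simpa using hwl)
        rw [if_pos (by omega)] at hwi hwl ⊢
        rw [Finset.mem_insert] at hwi hwl ⊢
        exact .inr (h4 w i j l hij hjl hlN (hwi.resolve_left hwv) (hwl.resolve_left hwv))
    · intro i hi
      split_ifs with hiN
      · exact (Finset.card_insert_le _ _).trans (Nat.succ_le_succ (h5 i hiN))
      · simp
  | @union n S T _ _ hd he ih1 ih2 =>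
    obtain ⟨N, bag, h1, h2, h3, h4, h5⟩ := ih1
    obtain ⟨M, bag', k1, k2, k3, k4, k5⟩ := ih2
    have hNM : ∀ i, i < N + M → ¬ i < N → i - N < M := by omega
    refine ⟨N + M, fun i => if i < N then bag i else bag' (i - N), ?_, ?_, ?_, ?_, ?_⟩
    · intro i hi
      split_ifs with hiN
      · exact (h1 i hiN).trans Set.subset_union_left
      · exact (k1 _ (hNM i hi hiN)).trans Set.subset_union_right
    · rintro v (hv | hv)
      · obtain ⟨i, hi, hvi⟩ := h2 v hv
        exact ⟨i, by omega, by simp [hi, hvi]⟩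
      · obtain ⟨i, hi, hvi⟩ := k2 v hv
        exact ⟨N + i, by omega, by simp [hvi]⟩
    · rintro u (hu | hu) v (hv | hv) huv
      · obtain ⟨i, hi, hui, hvi⟩ := h3 u hu v hv huv
        exact ⟨i, by omega, by simp [hi, hui], by simp [hi, hvi]⟩
      · exact absurd huv (he u hu v hv)
      · exact absurd huv.symm (he v hv u hu)
      · obtain ⟨i, hi, hui, hvi⟩ := k3 u hu v hv huv
        exact ⟨N + i, by omega, by simp [hui], by simp [hvi]⟩
    · intro v i j l hij hjl hl hvi hvl
      by_cases hlN : l < N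
      · rw [if_pos (by omega)] at hvi hvl ⊢
        exact h4 v i j l hij hjl hlN hvi hvl
      · rw [if_neg hlN] at hvl
        have hvT := k1 _ (hNM l hl hlN) hvl
        have hiN : ¬ i < N := by
          intro hiN
          rw [if_pos hiN] at hvi
          exact Set.disjoint_left.1 hd (h1 i hiN hvi) hvT
        rw [if_neg (by omega)] at hvi ⊢
        exact k4 v (i - N) (j - N) (l - N) (by omega) (by omega) (hNM l hl hlN) hvi hvl
    · intro i hi
      split_ifs with hiN
      · exact h5 i hiN
      · exact k5 _ (hNM i hi hiN)

theorem pathGraph_isTree (N : ℕ) : (SimpleGraph.pathGraph (N + 1)).IsTree := by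
  refine ⟨SimpleGraph.pathGraph_connected N, ?_⟩
  rw [SimpleGraph.isAcyclic_iff_forall_adj_isBridge]
  have key : ∀ a b : Fin (N + 1), (a : ℕ) + 1 = b →
      (SimpleGraph.pathGraph (N + 1)).IsBridge s(a, b) := by
    intro a b hab
    rw [SimpleGraph.isBridge_iff, SimpleGraph.reachable_iff_reflTransGen]
    intro hr
    have hle : ∀ y, Relation.ReflTransGen
        ((SimpleGraph.pathGraph (N + 1)).deleteEdges {s(a, b)}).Adj a y → (y : ℕ) ≤ a := by
      intro y hy
      induction hy with
      | refl => exact le_rfl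
      | @tail x y _ hxy ih =>
        have ih' : (x : ℕ) ≤ a := ih
        rw [SimpleGraph.deleteEdges_adj, SimpleGraph.pathGraph_adj, Set.mem_singleton_iff] at hxy
        by_contra hlt
        refine hxy.2 ?_
        rw [show x = a from Fin.ext (by omega), show y = b from Fin.ext (by omega)]
    have := hle b hr
    omega
  intro a b hab
  rcases SimpleGraph.pathGraph_adj.1 hab with h | h
  · exact key a b h
  · rw [Sym2.eq_swap]
    exact key b a h

theorem support_subset_of_isPath {T : SimpleGraph V} (hT : T.IsAcyclic) {a b : V}
    {p : T.Walk a b} (hp : p.IsPath) (q : T.Walk a b) : p.support ⊆ q.support := by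
  classical
  have h : (⟨p, hp⟩ : T.Path a b) = ⟨q.bypass, q.bypass_isPath⟩ :=
    (hT.subsingleton_path a b).elim _ _
  rw [show p = q.bypass from congrArg Subtype.val h]
  exact q.support_bypass_subset_support

theorem exists_walk_pathGraph (N : ℕ) (a b : Fin (N + 1)) (hab : a ≤ b) :
    ∃ p : (SimpleGraph.pathGraph (N + 1)).Walk a b, ∀ s ∈ p.support, a ≤ s ∧ s ≤ b := by
  obtain ⟨d, hd⟩ : ∃ d, (b : ℕ) = a + d := ⟨b - a, by omega⟩
  induction d generalizing b with
  | zero =>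
    obtain rfl : b = a := Fin.ext hd
    exact ⟨.nil, by simp⟩
  | succ d ih =>
    let c : Fin (N + 1) := ⟨a + d, by omega⟩
    have hac : a ≤ c := Nat.le_add_right _ _
    have hcb : c ≤ b := by
      show (a : ℕ) + d ≤ b
      omega
    obtain ⟨p, hp⟩ := ih c hac rfl
    have hadj : (SimpleGraph.pathGraph (N + 1)).Adj c b :=
      SimpleGraph.pathGraph_adj.2 (.inl (by show (a : ℕ) + d + 1 = b; omega))
    refine ⟨p.concat hadj, fun s hs => ?_⟩
    rw [SimpleGraph.Walk.support_concat, List.mem_append, List.mem_singleton] at hs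
    rcases hs with hs | rfl
    · exact ⟨(hp s hs).1, (hp s hs).2.trans hcb⟩
    · exact ⟨hab, le_rfl⟩

theorem exists_treeDecomposition_of_elim (h : Elim G n Set.univ) :
    ∃ D : TreeDecomposition G, D.width ≤ n - 1 := by
  obtain ⟨N, bag, h1, h2, h3, h4, h5⟩ := h.exists_isPathDecomposition
  have hconv : ∀ (a b : Fin (N + 1)), a ≤ b →
      ∀ (p : (SimpleGraph.pathGraph (N + 1)).Walk a b), p.IsPath → ∀ s ∈ p.support, ∀ v : V,
      (v ∈ if (a : ℕ) < N then bag a else ∅) → (v ∈ if (b : ℕ) < N then bag b else ∅) →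
      v ∈ if (s : ℕ) < N then bag s else ∅ := by
    intro a b hab p hp s hs v hva hvb
    obtain ⟨q, hq⟩ := exists_walk_pathGraph N a b hab
    obtain ⟨h6, h7⟩ := hq s (support_subset_of_isPath (pathGraph_isTree N).isAcyclic hp q hs)
    have h6' : (a : ℕ) ≤ s := h6
    have h7' : (s : ℕ) ≤ b := h7
    have hb : (b : ℕ) < N := by
      by_contra hb
      simp [hb] at hvb
    rw [if_pos hb] at hvb
    rw [if_pos (by omega)] at hva ⊢
    exact h4 v a s b h6' h7' hb hva hvb
  refine ⟨{
    Node := Fin (N + 1)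
    tree := SimpleGraph.pathGraph (N + 1)
    isTree := pathGraph_isTree N
    -- The last, empty bag is there because the tree needs a node even if the graph is empty.
    bag := fun i => if (i : ℕ) < N then bag i else ∅
    exists_mem_bag := fun v => ?_
    exists_edge_bag := fun u v huv => ?_
    mem_bag_of_mem_path := fun a b p hp s hs v hva hvb => ?_ }, ?_⟩
  · obtain ⟨i, hi, hv⟩ := h2 v trivial
    exact ⟨⟨i, by omega⟩, by simpa [hi] using hv⟩
  · obtain ⟨i, hi, hu, hv⟩ := h3 u trivial v trivial huv
    exact ⟨⟨i, by omega⟩, by simpa [hi] using hu, by simpa [hi] using hv⟩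
  · rcases le_total a b with hab | hab
    · exact hconv a b hab p hp s hs v hva hvb
    · exact hconv b a hab p.reverse hp.reverse s (by simpa using hs) v hvb hva
  · refine Nat.sub_le_sub_right (Finset.sup_le fun i _ => ?_) 1
    show (if (i : ℕ) < N then bag i else ∅).card ≤ n
    split_ifs with hi
    · exact h5 i hi
    · simp

theorem treewidth_le_treedepth [Fintype V] : treewidth V G ≤ treedepth V G := by
  obtain ⟨D, hD⟩ := exists_treeDecomposition_of_elim (treedepth_le_iff_elim (G := G).1 le_rfl)
  have : treewidth V G ≤ D.width := Nat.sInf_le ⟨D, rfl⟩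
  omega

end PathDecomposition

/-! ### The Hadwiger number is at most the treewidth plus one -/

section Helly

variable {V N : Type} {G : SimpleGraph V}

/-- Every nonempty set `X` of nodes of a tree that contains the paths between its elements has a
top node `t`: the path from any element of `X` to the root `r` stays in `X` up to `t`, and then
comes strictly closer to `r`. -/
theorem exists_top {T : SimpleGraph N} (hT : T.IsTree) (r : N) {X : Set N} (hne : X.Nonempty)
    (hX : ∀ a ∈ X, ∀ b ∈ X, ∀ p : T.Walk a b, p.IsPath → ∀ s ∈ p.support, s ∈ X) :
    ∃ t ∈ X, ∀ s ∈ X, ∀ p : T.Walk s r, p.IsPath → t ∈ p.support ∧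
      ∀ a ∈ p.support, a ∈ X ∨ T.dist r a ≤ T.dist r t ∧ (T.dist r a = T.dist r t → a = t) := by
  classical
  obtain ⟨t, ht, hmin⟩ := (measure fun a => T.dist r a).wf.has_min X hne
  have hmin' : ∀ a ∈ X, T.dist r t ≤ T.dist r a := fun a ha => not_lt.1 (hmin a ha)
  refine ⟨t, ht, fun s hs p hp => ?_⟩
  obtain ⟨q, hq⟩ := hT.connected.exists_walk_length_eq_dist r t
  have hqp : q.IsPath := q.isPath_of_length_eq_dist hq
  obtain ⟨c, hc, _⟩ := hT.existsUnique_path s t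
  have hqa : ∀ a ∈ q.support, T.dist r a ≤ T.dist r t ∧ (T.dist r a = T.dist r t → a = t) :=
    fun a ha => ⟨hq ▸ (SimpleGraph.dist_le (q.takeUntil a ha)).trans
        (q.length_takeUntil_le_length ha),
      fun h => eq_of_mem_support_geodesic q hq ha q.end_mem_support h⟩
  have hcq : (c.append q.reverse).IsPath := by
    rw [SimpleGraph.Walk.isPath_def, SimpleGraph.Walk.support_append]
    have hr : q.reverse.support.Nodup := hqp.reverse.support_nodup
    rw [← SimpleGraph.Walk.cons_tail_support] at hr
    refine List.Nodup.append hc.support_nodup hr.of_cons fun a ha ha' => ?_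
    have haX := hX s hs t ht c hc a ha
    have haq : a ∈ q.support := by
      have := List.mem_of_mem_tail ha'
      simpa using this
    have hat := (hqa a haq).2 (le_antisymm (hqa a haq).1 (hmin' a haX))
    exact (List.nodup_cons.1 hr).1 (hat ▸ ha')
  obtain rfl : p = c.append q.reverse := (hT.existsUnique_path s r).unique hp hcq
  refine ⟨by simp, fun a ha => ?_⟩
  rw [SimpleGraph.Walk.mem_support_append_iff] at ha
  rcases ha with ha | ha
  · exact .inl (hX s hs t ht c hc a ha)
  · exact .inr (hqa a (by simpa using ha))

/-- The Helly property of subtrees. -/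
theorem exists_common_node {T : SimpleGraph N} (hT : T.IsTree) {k : ℕ} (X : Fin k → Set N)
    (hX : ∀ x, ∀ a ∈ X x, ∀ b ∈ X x, ∀ p : T.Walk a b, p.IsPath → ∀ s ∈ p.support, s ∈ X x)
    (hpair : ∀ x y, (X x ∩ X y).Nonempty) : ∃ t, ∀ x, t ∈ X x := by
  obtain ⟨r⟩ := hT.connected.nonempty
  rcases k with _ | k
  · exact ⟨r, fun x => x.elim0⟩
  have hne : ∀ x, (X x).Nonempty := fun x => (hpair x x).mono Set.inter_subset_left
  choose t ht htop using fun x => exists_top hT r (hne x) (hX x)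
  obtain ⟨x, _, hx⟩ := Finset.exists_max_image Finset.univ (fun x => T.dist r (t x))
    Finset.univ_nonempty
  refine ⟨t x, fun y => ?_⟩
  obtain ⟨s, hsx, hsy⟩ := hpair x y
  obtain ⟨p, hp, _⟩ := hT.existsUnique_path s r
  have h1 := (htop x s hsx p hp).1
  rcases (htop y s hsy p hp).2 _ h1 with h2 | ⟨h2, h3⟩
  · exact h2
  · rw [h3 (le_antisymm h2 (hx y (Finset.mem_univ y)))]
    exact ht y

/-- The nodes whose bags meet a given branch set form a subtree, and any two of these subtrees
intersect, so that some bag meets all the branch sets. -/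
theorem TreeDecomposition.le_width_of_isMinor [Fintype V] (D : TreeDecomposition G) {k : ℕ}
    (h : IsMinor (⊤ : SimpleGraph (Fin k)) G) : k ≤ D.width + 1 := by
  classical
  obtain ⟨br, hconn, hdisj, hadj⟩ := h
  let X : Fin k → Set D.Node := fun x => {t | ∃ v ∈ br x, v ∈ D.bag t}
  have hX : ∀ x, ∀ a ∈ X x, ∀ b ∈ X x, ∀ p : D.tree.Walk a b, p.IsPath →
      ∀ s ∈ p.support, s ∈ X x := by
    rintro x a ⟨u, hu, hua⟩ b ⟨v, hv, hvb⟩ p hp s hs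
    have key : ∀ b, v ∈ D.bag b → ∀ p : D.tree.Walk a b, p.IsPath → ∀ s ∈ p.support, s ∈ X x := by
      refine reachable_within_ind (P := fun v => ∀ b, v ∈ D.bag b → ∀ p : D.tree.Walk a b,
        p.IsPath → ∀ s ∈ p.support, s ∈ X x) (connIn_of_connected (hconn x) u hu v hv) ?_ ?_
      · exact fun b hub p hp s hs => ⟨u, hu, D.mem_bag_of_mem_path a b p hp s hs u hua hub⟩
      · intro v w hP hvw _ hw b hwb p hp s hs
        obtain ⟨c, hvc, hwc⟩ := D.exists_edge_bag v w hvw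
        obtain ⟨q, hq, _⟩ := D.isTree.existsUnique_path a c
        obtain ⟨q', hq', _⟩ := D.isTree.existsUnique_path c b
        have := support_subset_of_isPath D.isTree.isAcyclic hp (q.append q') hs
        rw [SimpleGraph.Walk.mem_support_append_iff] at this
        rcases this with hs | hs
        · exact hP c hvc q hq s hs
        · exact ⟨w, hw, D.mem_bag_of_mem_path c b q' hq' s hs w hwc hwb⟩
    exact key b hvb p hp s hs
  have hpair : ∀ x y, (X x ∩ X y).Nonempty := by
    intro x y
    by_cases hxy : x = y
    · subst hxy
      obtain ⟨v⟩ := (hconn x).nonempty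
      obtain ⟨t, ht⟩ := D.exists_mem_bag v
      exact ⟨t, ⟨v, v.2, ht⟩, ⟨v, v.2, ht⟩⟩
    · obtain ⟨u, hu, v, hv, huv⟩ := hadj x y hxy
      obtain ⟨t, hut, hvt⟩ := D.exists_edge_bag u v huv
      exact ⟨t, ⟨u, hu, hut⟩, ⟨v, hv, hvt⟩⟩
  obtain ⟨t, ht⟩ := exists_common_node D.isTree X hX hpair
  choose f hf hft using ht
  have hinj : Function.Injective f := fun x y hxy => by
    by_contra hne
    exact Set.disjoint_left.1 (hdisj x y hne) (hf x) (hxy ▸ hf y)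
  have h1 : k ≤ (D.bag t).card := by
    have := Finset.card_le_card_of_injOn (s := Finset.univ) (t := D.bag t) f
      (fun x _ => hft x) hinj.injOn
    simpa using this
  have h2 := Finset.le_sup (f := fun t => (D.bag t).card) (Finset.mem_univ t)
  unfold TreeDecomposition.width
  omega

theorem hadwiger_le_treewidth [Fintype V] : hadwiger V G ≤ treewidth V G + 1 := by
  have hne : {w | ∃ D : TreeDecomposition G, D.width = w}.Nonempty := by
    obtain ⟨D, _⟩ := exists_treeDecomposition_of_elim (treedepth_le_iff_elim (G := G).1 le_rfl)
    exact ⟨_, D, rfl⟩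
  obtain ⟨D, hD⟩ := Nat.sInf_mem hne
  have hk : {k | IsMinor (⊤ : SimpleGraph (Fin k)) G}.Nonempty :=
    ⟨0, fun x => x.elim0, fun x => x.elim0, fun x => x.elim0, fun x => x.elim0⟩
  refine csSup_le hk fun k hk => ?_
  have := D.le_width_of_isMinor hk
  rwa [hD] at this

end Helly

/-! ### Weighted trees and their values -/

/-- A forest of uniform height `n` whose leaves carry a weight for every type in `τ`. The
constructor `node` lists the subtrees hanging off the children of a (virtual) common root, so that
the vertices of the forest are the children at all levels. -/
inductive NTree (τ : Type) : ℕ → Type 1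
  | leaf (w : τ → ℚ≥0) : NTree τ 0
  | node {n : ℕ} (I : Type) [Fintype I] (c : I → NTree τ n) : NTree τ (n + 1)

namespace NTree

variable {τ τ' D : Type} [Fintype D] {n : ℕ}

/-- The maximum, over all assignments of elements of `D` to the vertices, of the total value of the
leaves, where the weight for `t` of a leaf is multiplied by the value under `φ` of the assigned
elements on the path to that leaf. -/
def val {τ D : Type} [Fintype τ] [Fintype D] : {n : ℕ} → NTree τ n → (List D → τ → ℚ≥0) → ℚ≥0
  | _, leaf w, φ => ∑ t, w t * φ [] t
  | _, node _ c, φ => ∑ i, Finset.univ.sup fun a => (c i).val fun p => φ (a :: p)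

/-- The total weight for `t` of the leaves. -/
def mass {τ : Type} (t : τ) : {n : ℕ} → NTree τ n → ℚ≥0
  | _, leaf w => w t
  | _, node _ c => ∑ i, (c i).mass t

/-- The forest with the weights for `t` multiplied by `s t`. -/
def rescale {τ : Type} (s : τ → ℚ≥0) : {n : ℕ} → NTree τ n → NTree τ n
  | _, leaf w => leaf fun t => s t * w t
  | _, node I c => node I fun i => (c i).rescale s

/-- The forest with types renamed along `e`. -/
def relabel {τ τ' : Type} (e : τ' → τ) : {n : ℕ} → NTree τ n → NTree τ' n
  | _, leaf w => leaf fun t => w (e t)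
  | _, node I c => node I fun i => (c i).relabel e

/-- The vertices of the forest. -/
def Vert {τ : Type} : {n : ℕ} → NTree τ n → Type
  | _, leaf _ => Empty
  | _, node I c => Σ i : I, Option (c i).Vert

instance fintypeVert {τ : Type} : {n : ℕ} → (T : NTree τ n) → Fintype T.Vert
  | _, leaf _ => inferInstanceAs (Fintype Empty)
  | _, node I c =>
    have := fun i => fintypeVert (c i)
    inferInstanceAs (Fintype (Σ i : I, Option (c i).Vert))

theorem mass_rescale (s : τ → ℚ≥0) (T : NTree τ n) (t : τ) :
    (T.rescale s).mass t = s t * T.mass t := by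
  induction T with
  | leaf w => rfl
  | node I c ih => simp only [rescale, mass, ih, Finset.mul_sum]

theorem card_vert_rescale (s : τ → ℚ≥0) (T : NTree τ n) :
    Nat.card (T.rescale s).Vert = Nat.card T.Vert := by
  refine Nat.card_congr ?_
  induction T with
  | leaf w => exact .refl _
  | node I c ih => exact Equiv.sigmaCongrRight fun i => Equiv.optionCongr (ih i)

theorem mass_relabel (e : τ' → τ) (T : NTree τ n) (t : τ') :
    (T.relabel e).mass t = T.mass (e t) := by
  induction T with
  | leaf w => rfl
  | node I c ih => simp only [relabel, mass, ih]

theorem card_vert_relabel (e : τ' → τ) (T : NTree τ n) :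
    Nat.card (T.relabel e).Vert = Nat.card T.Vert := by
  refine Nat.card_congr ?_
  induction T with
  | leaf w => exact .refl _
  | node I c ih => exact Equiv.sigmaCongrRight fun i => Equiv.optionCongr (ih i)

variable [Fintype τ] [Fintype τ']

theorem val_rescale (s : τ → ℚ≥0) (T : NTree τ n) (φ : List D → τ → ℚ≥0) :
    (T.rescale s).val φ = T.val fun p t => s t * φ p t := by
  induction T generalizing φ with
  | leaf w => exact Finset.sum_congr rfl fun t _ => by ring
  | node I c ih => simp only [rescale, val, ih]

theorem val_relabel (e : τ' ≃ τ) (T : NTree τ n) (φ : List D → τ' → ℚ≥0) :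
    (T.relabel e).val φ = T.val fun p t => φ p (e.symm t) := by
  induction T generalizing φ with
  | leaf w => exact Fintype.sum_equiv e _ _ fun t => by simp
  | node I c ih => simp only [relabel, val, ih]

theorem val_congr {T : NTree τ n} {φ ψ : List D → τ → ℚ≥0}
    (h : ∀ p t, T.mass t ≠ 0 → φ p t = ψ p t) : T.val φ = T.val ψ := by
  induction T generalizing φ ψ with
  | leaf w =>
    refine Finset.sum_congr rfl fun t _ => ?_
    by_cases hw : w t = 0
    · rw [hw, zero_mul, zero_mul]
    · rw [h [] t hw]
  | node I c ih =>
    refine Finset.sum_congr rfl fun i _ => congrArg _ (funext fun a => ih i fun p t ht => ?_)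
    refine h _ t fun h0 => ht ?_
    exact (Finset.sum_eq_zero_iff.1 h0) i (Finset.mem_univ i)

theorem val_const_mul (r : ℚ≥0) (T : NTree τ n) (φ : List D → τ → ℚ≥0) :
    (T.val fun p t => r * φ p t) = r * T.val φ := by
  induction T generalizing φ with
  | leaf w =>
    simp only [val, Finset.mul_sum]
    exact Finset.sum_congr rfl fun t _ => by ring
  | node I c ih =>
    simp only [val, ih, Finset.mul_sum]
    refine Finset.sum_congr rfl fun i _ => ?_
    exact (Finset.mul_sup₀ _ _ r).symm

/-- The assignment depending on the level only bounds the value from below. -/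
theorem mass_mul_le_val (T : NTree τ n) (φ : List D → τ → ℚ≥0) (p : List D) (hp : p.length = n)
    (t : τ) : T.mass t * φ p t ≤ T.val φ := by
  induction T generalizing p φ with
  | leaf w =>
    rw [List.length_eq_zero_iff.1 hp]
    exact Finset.single_le_sum (f := fun t => w t * φ [] t) (fun _ _ => zero_le)
      (Finset.mem_univ t)
  | @node n I _ c ih =>
    obtain ⟨a, p, rfl⟩ := List.exists_of_length_succ p hp
    simp only [mass, val, Finset.sum_mul]
    refine Finset.sum_le_sum fun i _ => ?_
    exact (ih i (φ := fun p => φ (a :: p)) (p := p) (by simpa using hp)).trans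
      (Finset.le_sup (f := fun a => (c i).val fun p => φ (a :: p)) (Finset.mem_univ a))

theorem val_le (T : NTree τ n) {φ : List D → τ → ℚ≥0} {b : ℚ≥0}
    (hφ : ∀ p t, p.length = n → φ p t ≤ b) : T.val φ ≤ (∑ t, T.mass t) * b := by
  induction T generalizing φ with
  | leaf w =>
    simp only [val, mass, Finset.sum_mul]
    exact Finset.sum_le_sum fun t _ => by gcongr; exact hφ [] t rfl
  | node I c ih =>
    simp only [val, mass]
    rw [Finset.sum_comm, Finset.sum_mul]
    refine Finset.sum_le_sum fun i _ => Finset.sup_le fun a _ => ih i fun p t hp => ?_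
    exact hφ _ t (by simpa using hp)

/-! ### Approximation by finitely many weighted trees -/

/-- The values of the two forests differ by at most `δ` times any bound on the evaluation
function. -/
def Close (δ : ℚ≥0) (T T' : NTree τ n) : Prop :=
  ∀ (D : Type) [Fintype D] (φ : List D → τ → ℚ≥0) (b : ℚ≥0),
    (∀ p t, p.length = n → φ p t ≤ b) →
      T.val φ ≤ T'.val φ + δ * b ∧ T'.val φ ≤ T.val φ + δ * b

theorem exists_nnrat_round {M : ℕ} (hM : 0 < M) {r : ℚ≥0} (hr : r ≤ 1) :
    ∃ i : Fin (M + 1), ((i : ℕ) : ℚ≥0) / M ≤ r ∧ r ≤ ((i : ℕ) : ℚ≥0) / M + 1 / M := by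
  have hM' : (0 : ℚ≥0) < M := by exact_mod_cast hM
  have h1 : ⌊r * M⌋₊ < M + 1 := by
    rw [Nat.floor_lt zero_le]
    push_cast
    calc r * M ≤ 1 * M := by gcongr
      _ < M + 1 := by rw [one_mul]; exact lt_add_one _
  refine ⟨⟨⌊r * M⌋₊, h1⟩, ?_, ?_⟩
  · rw [div_le_iff₀ hM']
    exact Nat.floor_le zero_le
  · rw [← add_div, le_div_iff₀ hM']
    exact (Nat.lt_floor_add_one (r * M)).le

/-- Forests of total weight at most `1` lie close to finitely many ones. By induction on the height:
the subtrees, scaled to total weight `1`, are replaced by close members of the net for the smaller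
height, equal subtrees are merged by adding their weights, and these weights are rounded to
multiples of `1 / M`. -/
theorem exists_net (τ : Type) [Fintype τ] (n : ℕ) (δ : ℚ≥0) (hδ : 0 < δ) :
    ∃ (J : Type) (_ : Fintype J) (c : J → NTree τ n), (∀ j, ∑ t, (c j).mass t ≤ 1) ∧
      ∀ T : NTree τ n, ∑ t, T.mass t ≤ 1 → ∃ j, Close δ T (c j) := by
  classical
  induction n generalizing δ with
  | zero =>
    obtain ⟨M, hM⟩ := exists_nat_gt (Fintype.card τ / δ)
    have hM0 : 0 < M := by
      have : (0 : ℚ≥0) < M := lt_of_le_of_lt zero_le hM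
      exact_mod_cast this
    have hM' : (0 : ℚ≥0) < M := by exact_mod_cast hM0
    have hcard : (Fintype.card τ : ℚ≥0) * (1 / M) ≤ δ := by
      rw [mul_one_div, div_le_iff₀ hM']
      rw [div_lt_iff₀ hδ, mul_comm] at hM
      exact hM.le
    refine ⟨{q : τ → Fin (M + 1) // ∑ t, ((q t : ℕ) : ℚ≥0) / M ≤ 1}, inferInstance,
      fun q => leaf fun t => ((q.1 t : ℕ) : ℚ≥0) / M, fun q => q.2, fun T hT => ?_⟩
    cases T with
    | leaf w =>
      have hw : ∀ t, w t ≤ 1 := fun t =>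
        (Finset.single_le_sum (f := fun t => w t) (fun _ _ => zero_le) (Finset.mem_univ t)).trans hT
      choose q hq1 hq2 using fun t => exists_nnrat_round hM0 (hw t)
      refine ⟨⟨q, (Finset.sum_le_sum fun t _ => hq1 t).trans hT⟩, fun D _ φ b hφ => ⟨?_, ?_⟩⟩
      · calc ∑ t, w t * φ [] t
            ≤ ∑ t, (((q t : ℕ) : ℚ≥0) / M * φ [] t + 1 / M * b) := by
              refine Finset.sum_le_sum fun t _ => ?_
              calc w t * φ [] t ≤ (((q t : ℕ) : ℚ≥0) / M + 1 / M) * φ [] t := by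
                    gcongr; exact hq2 t
                _ ≤ _ := by
                    rw [add_mul]
                    gcongr
                    exact hφ [] t rfl
          _ = ∑ t, ((q t : ℕ) : ℚ≥0) / M * φ [] t + Fintype.card τ * (1 / M) * b := by
              rw [Finset.sum_add_distrib, Finset.sum_const, Finset.card_univ, nsmul_eq_mul,
                mul_assoc]
          _ ≤ _ := by
              gcongr
              exact le_rfl
      · refine le_add_of_le_of_nonneg ?_ zero_le
        exact Finset.sum_le_sum fun t _ => by gcongr; exact hq1 t
  | succ n ih =>
    obtain ⟨J, _, c, hc, hnet⟩ := ih (δ / 2) (by positivity)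
    obtain ⟨M, hM⟩ := exists_nat_gt (Fintype.card J / (δ / 2))
    have hM0 : 0 < M := by
      have : (0 : ℚ≥0) < M := lt_of_le_of_lt zero_le hM
      exact_mod_cast this
    have hM' : (0 : ℚ≥0) < M := by exact_mod_cast hM0
    have hcard : (Fintype.card J : ℚ≥0) * (1 / M) ≤ δ / 2 := by
      rw [mul_one_div, div_le_iff₀ hM']
      rw [div_lt_iff₀ (by positivity), mul_comm] at hM
      exact hM.le
    -- A forest is replaced by one with a single subtree for each member of the net below.
    let F : (J → ℚ≥0) → NTree τ (n + 1) := fun μ => node J fun j => (c j).rescale fun _ => μ j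
    have hFval : ∀ (μ : J → ℚ≥0) (D : Type) [Fintype D] (φ : List D → τ → ℚ≥0), (F μ).val φ =
        ∑ j, μ j * Finset.univ.sup fun a => (c j).val fun p => φ (a :: p) := by
      intro μ D _ φ
      simp only [F, val, val_rescale, val_const_mul]
      exact Finset.sum_congr rfl fun j _ => (Finset.mul_sup₀ _ _ _).symm
    have hFmass : ∀ μ, ∑ t, (F μ).mass t ≤ ∑ j, μ j := by
      intro μ
      simp only [F, mass, mass_rescale]
      rw [Finset.sum_comm]
      refine Finset.sum_le_sum fun j _ => ?_
      rw [← Finset.mul_sum]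
      exact mul_le_of_le_one_right zero_le (hc j)
    refine ⟨{q : J → Fin (M + 1) // ∑ t, (F fun j => ((q j : ℕ) : ℚ≥0) / M).mass t ≤ 1},
      inferInstance, fun q => F fun j => ((q.1 j : ℕ) : ℚ≥0) / M, fun q => q.2, fun T hT => ?_⟩
    cases T with
    | node I d =>
      let lam : I → ℚ≥0 := fun i => ∑ t, (d i).mass t
      have hlam : ∑ i, lam i ≤ 1 := by
        refine le_trans (le_of_eq ?_) hT
        simp only [lam, mass]
        exact Finset.sum_comm
      have hscale : ∀ i, ∑ t, ((d i).rescale fun _ => (lam i)⁻¹).mass t ≤ 1 := by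
        intro i
        simp only [mass_rescale]
        rw [← Finset.mul_sum]
        exact inv_mul_le_one
      choose j hj using fun i => hnet _ (hscale i)
      have hval : ∀ (i : I) (D : Type) [Fintype D] (φ : List D → τ → ℚ≥0),
          (d i).val φ = lam i * ((d i).rescale fun _ => (lam i)⁻¹).val φ := by
        intro i D _ φ
        rw [val_rescale, val_const_mul, ← mul_assoc]
        by_cases h0 : lam i = 0
        · rw [h0, inv_zero, mul_zero, zero_mul]
          have h1 : ∀ t, (d i).mass t = 0 := fun t =>
            (Finset.sum_eq_zero_iff.1 h0) t (Finset.mem_univ t)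
          rw [val_congr (ψ := fun _ _ => 0 * 0) fun p t ht => absurd (h1 t) ht, val_const_mul,
            zero_mul]
        · rw [mul_inv_cancel₀ h0, one_mul]
      let μ : J → ℚ≥0 := fun k => ∑ i, if j i = k then lam i else 0
      have hμsum : ∀ V : J → ℚ≥0, ∑ k, μ k * V k = ∑ i, lam i * V (j i) := by
        intro V
        simp only [μ, Finset.sum_mul, ite_mul, zero_mul]
        rw [Finset.sum_comm]
        exact Finset.sum_congr rfl fun i _ => by
          rw [Finset.sum_ite_eq, if_pos (Finset.mem_univ _)]
      have hμ1 : ∑ k, μ k ≤ 1 := by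
        have := hμsum fun _ => 1
        simp only [mul_one] at this
        rw [this]
        exact hlam
      have hμ : ∀ k, μ k ≤ 1 := fun k =>
        (Finset.single_le_sum (f := μ) (fun _ _ => zero_le) (Finset.mem_univ k)).trans hμ1
      choose q hq1 hq2 using fun k => exists_nnrat_round hM0 (hμ k)
      refine ⟨⟨q, (hFmass _).trans ((Finset.sum_le_sum fun k _ => hq1 k).trans hμ1)⟩,
        fun D _ φ b hφ => ?_⟩
      let V : J → ℚ≥0 := fun k => Finset.univ.sup fun a : D => (c k).val fun p => φ (a :: p)
      have hφ' : ∀ a : D, ∀ p t, p.length = n → φ (a :: p) t ≤ b := fun a p t hp =>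
        hφ _ t (by simpa using hp)
      have hVb : ∀ k, V k ≤ b := fun k => Finset.sup_le fun a _ =>
        ((c k).val_le (hφ' a)).trans (mul_le_of_le_one_left zero_le (hc k))
      have hsub : ∀ i, (Finset.univ.sup fun a : D => (d i).val fun p => φ (a :: p)) ≤
          lam i * V (j i) + lam i * (δ / 2 * b) ∧
          lam i * V (j i) ≤ (Finset.univ.sup fun a : D => (d i).val fun p => φ (a :: p)) +
            lam i * (δ / 2 * b) := by
        intro i
        constructor
        · refine Finset.sup_le fun a _ => ?_
          rw [hval, ← mul_add]
          gcongr
          refine (hj i D _ b (hφ' a)).1.trans ?_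
          gcongr
          exact Finset.le_sup (f := fun a => (c (j i)).val fun p => φ (a :: p)) (Finset.mem_univ a)
        · simp only [V]
          rw [Finset.mul_sup₀]
          refine Finset.sup_le fun a _ => ?_
          calc lam i * (c (j i)).val (fun p => φ (a :: p))
              ≤ lam i * (((d i).rescale fun _ => (lam i)⁻¹).val (fun p => φ (a :: p)) +
                δ / 2 * b) := by gcongr; exact (hj i D _ b (hφ' a)).2
            _ = (d i).val (fun p => φ (a :: p)) + lam i * (δ / 2 * b) := by rw [mul_add, ← hval]
            _ ≤ _ := by
                gcongr
                exact Finset.le_sup (f := fun a => (d i).val fun p => φ (a :: p))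
                  (Finset.mem_univ a)
      have hlamb : ∑ i, lam i * (δ / 2 * b) ≤ δ / 2 * b := by
        rw [← Finset.sum_mul]
        exact mul_le_of_le_one_left zero_le hlam
      have hround : ∑ k, μ k * V k ≤ ∑ k, ((q k : ℕ) : ℚ≥0) / M * V k + δ / 2 * b := by
        calc ∑ k, μ k * V k ≤ ∑ k, (((q k : ℕ) : ℚ≥0) / M * V k + 1 / M * b) := by
              refine Finset.sum_le_sum fun k _ => ?_
              calc μ k * V k ≤ (((q k : ℕ) : ℚ≥0) / M + 1 / M) * V k := by gcongr; exact hq2 k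
                _ ≤ _ := by
                    rw [add_mul]
                    gcongr
                    exact hVb k
          _ = ∑ k, ((q k : ℕ) : ℚ≥0) / M * V k + Fintype.card J * (1 / M) * b := by
              rw [Finset.sum_add_distrib, Finset.sum_const, Finset.card_univ, nsmul_eq_mul,
                mul_assoc]
          _ ≤ _ := by gcongr
      have hδb : δ / 2 * b + δ / 2 * b = δ * b := by rw [← add_mul, add_halves]
      rw [hFval]
      constructor
      · calc (node I d).val φ ≤ ∑ i, (lam i * V (j i) + lam i * (δ / 2 * b)) :=
              Finset.sum_le_sum fun i _ => (hsub i).1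
          _ ≤ ∑ k, μ k * V k + δ / 2 * b := by
              rw [Finset.sum_add_distrib, hμsum]
              gcongr
          _ ≤ ∑ k, ((q k : ℕ) : ℚ≥0) / M * V k + δ / 2 * b + δ / 2 * b := by gcongr
          _ = _ := by rw [add_assoc, hδb]
      · calc ∑ k, ((q k : ℕ) : ℚ≥0) / M * V k ≤ ∑ k, μ k * V k :=
              Finset.sum_le_sum fun k _ => by gcongr; exact hq1 k
          _ = ∑ i, lam i * V (j i) := hμsum V
          _ ≤ (node I d).val φ + ∑ i, lam i * (δ / 2 * b) := by
              simp only [val]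
              rw [← Finset.sum_add_distrib]
              exact Finset.sum_le_sum fun i _ => (hsub i).2
          _ ≤ (node I d).val φ + δ * b := by
              gcongr
              refine hlamb.trans ?_
              rw [← hδb]
              exact le_add_of_nonneg_right zero_le

/-- Every forest of total weight at most `1` lies close to one with a number of vertices bounded
in terms of the height and the number of types. -/
theorem exists_close_card_le (m n : ℕ) (δ : ℚ≥0) (hδ : 0 < δ) :
    ∃ K : ℕ, ∀ (τ : Type) [Fintype τ], Fintype.card τ = m → ∀ T : NTree τ n,
      ∑ t, T.mass t ≤ 1 → ∃ T' : NTree τ n, Nat.card T'.Vert ≤ K ∧ Close δ T T' := by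
  obtain ⟨J, _, c, _, hnet⟩ := exists_net (Fin m) n δ hδ
  refine ⟨Finset.univ.sup fun j => Nat.card (c j).Vert, fun τ _ hτ T hT => ?_⟩
  let e : τ ≃ Fin m := Fintype.equivFinOfCardEq hτ
  have hT' : ∑ t, (T.relabel e.symm).mass t ≤ 1 := by
    simp only [mass_relabel]
    rwa [Equiv.sum_comp e.symm fun t => T.mass t]
  obtain ⟨j, hj⟩ := hnet _ hT'
  refine ⟨(c j).relabel e, ?_, fun D _ φ b hφ => ?_⟩
  · rw [card_vert_relabel]
    exact Finset.le_sup (f := fun j => Nat.card (c j).Vert) (Finset.mem_univ j)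
  · have := hj D (fun p t => φ p (e.symm t)) b fun p t hp => hφ p _ hp
    rw [val_relabel] at this ⊢
    simpa using this

/-- The multiplicative form of the approximation: every type is normalised to have total weight
`1 / m`, which makes any value of the evaluation function at most `m` times the value of the
forest. -/
theorem exists_val_close_card_le (m n : ℕ) (δ : ℚ≥0) (hδ : 0 < δ) :
    ∃ K : ℕ, ∀ (τ : Type) [Fintype τ], Fintype.card τ = m → ∀ T : NTree τ n,
      ∃ T' : NTree τ n, Nat.card T'.Vert ≤ K ∧
        ∀ (D : Type) [Fintype D] (φ : List D → τ → ℚ≥0),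
          T.val φ ≤ T'.val φ + δ * T.val φ ∧ T'.val φ ≤ T.val φ + δ * T.val φ := by
  obtain ⟨K, hK⟩ := exists_close_card_le m n (δ / (m + 1)) (by positivity)
  refine ⟨K, fun τ _ hτ T => ?_⟩
  let s : τ → ℚ≥0 := fun t => T.mass t * (m + 1)
  have hmass : ∑ t, (T.rescale fun t => (s t)⁻¹).mass t ≤ 1 := by
    simp only [mass_rescale]
    calc ∑ t, (s t)⁻¹ * T.mass t ≤ ∑ _t : τ, (1 : ℚ≥0) / (m + 1) := by
          refine Finset.sum_le_sum fun t _ => ?_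
          by_cases h0 : T.mass t = 0
          · rw [h0, mul_zero]
            exact zero_le
          · refine le_of_eq ?_
            simp only [s]
            field_simp
      _ ≤ 1 := by
          rw [Finset.sum_const, Finset.card_univ, hτ, nsmul_eq_mul, mul_one_div]
          exact div_le_one_of_le₀ (by simp) zero_le
  obtain ⟨T', hT', hclose⟩ := hK τ hτ _ hmass
  refine ⟨T'.rescale s, (card_vert_rescale s T').trans_le hT', fun D _ φ => ?_⟩
  have h1 := hclose D (fun p t => s t * φ p t) ((m + 1) * T.val φ) fun p t hp => by
    have := T.mass_mul_le_val φ p hp t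
    calc s t * φ p t = (m + 1) * (T.mass t * φ p t) := by simp only [s]; ring
      _ ≤ _ := by gcongr
  have h2 : (T.rescale fun t => (s t)⁻¹).val (fun p t => s t * φ p t) = T.val φ := by
    rw [val_rescale]
    refine val_congr fun p t ht => ?_
    have : s t ≠ 0 := mul_ne_zero ht (by positivity)
    rw [← mul_assoc, inv_mul_cancel₀ this, one_mul]
  have h3 : δ / (m + 1) * ((m + 1) * T.val φ) = δ * T.val φ := by
    field_simp
  rw [h2, h3] at h1
  rw [val_rescale]
  exact h1

end NTree

/-! ### From weighted trees to structures -/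

namespace NTree

variable {τ D : Type} {n : ℕ}

/-- The leaves of the forest. -/
def Leaf {τ : Type} : {n : ℕ} → NTree τ n → Type
  | _, leaf _ => Unit
  | _, node I c => Σ i : I, (c i).Leaf

instance fintypeLeaf {τ : Type} : {n : ℕ} → (T : NTree τ n) → Fintype T.Leaf
  | _, leaf _ => inferInstanceAs (Fintype Unit)
  | _, node I c =>
    have := fun i => fintypeLeaf (c i)
    inferInstanceAs (Fintype (Σ i : I, (c i).Leaf))

/-- The vertices on the path to a leaf. -/
def path {τ : Type} : {n : ℕ} → (T : NTree τ n) → T.Leaf → List T.Vert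
  | _, leaf _ => fun _ => []
  | _, node _ c => fun l => ⟨l.1, none⟩ :: ((c l.1).path l.2).map fun x => ⟨l.1, some x⟩

/-- The weights of a leaf. -/
def weight {τ : Type} : {n : ℕ} → (T : NTree τ n) → T.Leaf → τ → ℚ≥0
  | _, leaf w => fun _ => w
  | _, node _ c => fun l => (c l.1).weight l.2

theorem length_path (T : NTree τ n) (l : T.Leaf) : (T.path l).length = n := by
  induction T with
  | leaf w => rfl
  | node I c ih =>
    exact congrArg Nat.succ ((List.length_map _).trans (ih l.1 l.2))

variable [Fintype τ]

theorem sum_weight_node {I : Type} [Fintype I] (c : I → NTree τ n)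
    (h : (node I c).Vert → D) (φ : List D → τ → ℚ≥0) :
    ∑ l, ∑ t, (node I c).weight l t * φ (((node I c).path l).map h) t =
      ∑ i, ∑ l, ∑ t, (c i).weight l t *
        φ (h ⟨i, none⟩ :: ((c i).path l).map fun x => h ⟨i, some x⟩) t := by
  refine (Fintype.sum_sigma (fun l : Σ i : I, (c i).Leaf => ∑ t, (node I c).weight l t *
    φ (((node I c).path l).map h) t)).trans ?_
  have hpath : ∀ i l, ((node I c).path ⟨i, l⟩).map h =
      h ⟨i, none⟩ :: ((c i).path l).map fun x => h ⟨i, some x⟩ :=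
    fun i l => congrArg (List.cons _) List.map_map
  refine Finset.sum_congr rfl fun i _ => Finset.sum_congr rfl fun l _ => ?_
  rw [hpath]
  rfl

variable [Fintype D]

theorem sum_weight_le_val (T : NTree τ n) (h : T.Vert → D) (φ : List D → τ → ℚ≥0) :
    ∑ l, ∑ t, T.weight l t * φ ((T.path l).map h) t ≤ T.val φ := by
  induction T generalizing φ with
  | leaf w => exact (Fintype.sum_unique (ι := Unit) _).le
  | node I c ih =>
    rw [sum_weight_node]
    refine Finset.sum_le_sum fun i _ => ?_
    exact (ih i (fun x => h ⟨i, some x⟩) fun p => φ (h ⟨i, none⟩ :: p)).trans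
      (Finset.le_sup (f := fun a => (c i).val fun p => φ (a :: p)) (Finset.mem_univ _))

theorem exists_sum_weight_eq_val [Nonempty D] (T : NTree τ n) (φ : List D → τ → ℚ≥0) :
    ∃ h : T.Vert → D, ∑ l, ∑ t, T.weight l t * φ ((T.path l).map h) t = T.val φ := by
  induction T generalizing φ with
  | leaf w => exact ⟨fun x => Empty.elim x, Fintype.sum_unique (ι := Unit) _⟩
  | node I c ih =>
    choose a _ ha using fun i => Finset.exists_mem_eq_sup Finset.univ Finset.univ_nonempty
      fun a => (c i).val fun p => φ (a :: p)
    choose h hh using fun i => ih i fun p => φ (a i :: p)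
    refine ⟨fun x => x.2.elim (a x.1) (h x.1), ?_⟩
    rw [sum_weight_node]
    refine Finset.sum_congr rfl fun i _ => ?_
    rw [ha i, ← hh i]
    rfl

end NTree

section TreeStructure

variable {σ : Signature} {k : ℕ}

/-- The types of tuples along a path with `k` vertices: a symbol and the position on the path of
each entry. -/
abbrev PathType (σ : Signature) (k : ℕ) : Type := Σ f : σ.Symb, (Fin (σ.arity f) → Fin k)

/-- The value in `C` of a tuple of the given type, where `q` lists the images of the vertices of
the path. (The default is used only for positions beyond the end of `q`.) -/
noncomputable def evalPath (C : ValuedStructure σ) (q : List C.Dom) (t : PathType σ k) : ℚ≥0 :=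
  C.val t.1 fun i => q.getD (t.2 i) (Classical.arbitrary C.Dom)

/-- The structure whose tuples of positive value lie on the paths of a forest. One isolated vertex
is added, as the forest may be empty. -/
noncomputable def NTree.toStructure (T : NTree (PathType σ k) k) : ValuedStructure σ :=
  ofTuples (D := Option T.Vert) (I := fun f => T.Leaf × (Fin (σ.arity f) → Fin k))
    (fun f e => T.weight e.1 ⟨f, e.2⟩) (fun _ e i => (T.path e.1)[(e.2 i : ℕ)]?)

theorem NTree.mapVal_toStructure (T : NTree (PathType σ k) k) (C : ValuedStructure σ)
    (h : Option T.Vert → C.Dom) : mapVal T.toStructure C h =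
      ∑ l, ∑ t, T.weight l t * evalPath C ((T.path l).map fun x => h (some x)) t := by
  refine (mapVal_ofTuples _ _ C h).trans ?_
  simp_rw [Fintype.sum_prod_type, Fintype.sum_sigma]
  rw [Finset.sum_comm]
  refine Finset.sum_congr rfl fun l _ => Finset.sum_congr rfl fun f _ =>
    Finset.sum_congr rfl fun t _ => ?_
  congr 2
  funext i
  have hi : (t i : ℕ) < (T.path l).length := by
    rw [T.length_path]
    exact (t i).2
  simp [hi]

theorem NTree.opt_toStructure (T : NTree (PathType σ k) k) (C : ValuedStructure σ) :
    opt T.toStructure C = T.val (evalPath C) := by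
  apply le_antisymm
  · obtain ⟨h, hh⟩ := exists_mapVal_eq_opt T.toStructure C
    rw [← hh]
    exact (T.mapVal_toStructure C h).trans_le (T.sum_weight_le_val (fun x => h (some x)) _)
  · obtain ⟨h, hh⟩ := T.exists_sum_weight_eq_val (evalPath C)
    let g : Option T.Vert → C.Dom := fun o => o.elim (Classical.arbitrary C.Dom) h
    have hg : mapVal T.toStructure C g = T.val (evalPath C) :=
      (T.mapVal_toStructure C g).trans hh
    rw [← hg]
    exact mapVal_le_opt (A := T.toStructure) g

end TreeStructure

/-! ### From structures of bounded treedepth to weighted trees -/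

section OfElim

variable {σ : Signature} {A : ValuedStructure σ} {k n : ℕ}

/-- The value of a map on a set of tuples. -/
def tupleVal {A : ValuedStructure σ} (C : ValuedStructure σ)
    (E : Finset (Σ f : σ.Symb, (Fin (σ.arity f) → A.Dom))) (h : A.Dom → C.Dom) : ℚ≥0 :=
  ∑ e ∈ E, A.val e.1 e.2 * C.val e.1 (h ∘ e.2)

/-- The value of `T`, continuing the path `p`, is the maximal value on the tuples in `E` of a map
that is prescribed outside of `S`. -/
def Represents (A : ValuedStructure σ) (p : List A.Dom) (S : Set A.Dom)
    (E : Finset (Σ f : σ.Symb, (Fin (σ.arity f) → A.Dom))) (T : NTree (PathType σ k) n) : Prop :=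
  ∀ (C : ValuedStructure σ) (g : A.Dom → C.Dom),
    (∀ h : A.Dom → C.Dom, (∀ v, v ∉ S → h v = g v) →
      tupleVal C E h ≤ T.val fun q => evalPath C (p.map g ++ q)) ∧
    ∃ h : A.Dom → C.Dom, (∀ v, v ∉ S → h v = g v) ∧
      tupleVal C E h = T.val fun q => evalPath C (p.map g ++ q)

/-- A forest that consists of one path. -/
def NTree.chain {τ : Type} (w : τ → ℚ≥0) : (n : ℕ) → NTree τ n
  | 0 => .leaf w
  | n + 1 => .node Unit fun _ => NTree.chain w n

theorem NTree.val_chain {τ D : Type} [Fintype τ] [Fintype D] [Nonempty D] {w : τ → ℚ≥0}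
    {φ : List D → τ → ℚ≥0} {κ : τ → ℚ≥0} (h : ∀ q t, w t ≠ 0 → φ q t = κ t) :
    (NTree.chain w n).val φ = ∑ t, w t * κ t := by
  induction n generalizing φ with
  | zero =>
    refine Finset.sum_congr rfl fun t _ => ?_
    by_cases hw : w t = 0
    · rw [hw, zero_mul, zero_mul]
    · rw [h [] t hw]
  | succ n ih =>
    have h1 : ∀ a, ((NTree.chain w n).val fun p => φ (a :: p)) = ∑ t, w t * κ t :=
      fun a => ih fun q t ht => h _ t ht
    simp only [NTree.chain, NTree.val, h1]
    rw [Finset.sup_const Finset.univ_nonempty]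
    exact Fintype.sum_unique (ι := Unit) _

/-- If no vertex is left to map, all the tuples lie on the path `p`, and a single path carrying
their values represents them. -/
theorem exists_represents_empty (p : List A.Dom) (hp : p.length ≤ k)
    (E : Finset (Σ f : σ.Symb, (Fin (σ.arity f) → A.Dom))) (hE : ∀ e ∈ E, ∀ i, e.2 i ∈ p) (n : ℕ) :
    ∃ T : NTree (PathType σ k) n, Represents A p ∅ E T := by
  classical
  have hl : ∀ e : E, ∃ l : Fin (σ.arity e.1.1) → Fin k, ∀ i, p[(l i : ℕ)]? = some (e.1.2 i) := by
    intro e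
    have : ∀ i, ∃ j : Fin k, p[(j : ℕ)]? = some (e.1.2 i) := fun i => by
      obtain ⟨j, hj, hji⟩ := List.mem_iff_getElem.1 (hE e.1 e.2 i)
      exact ⟨⟨j, by omega⟩, by rw [← hji]; exact List.getElem?_eq_getElem hj⟩
    choose l hl using this
    exact ⟨l, hl⟩
  choose l hl using hl
  let w : PathType σ k → ℚ≥0 := fun t =>
    ∑ e : E, if (⟨e.1.1, l e⟩ : PathType σ k) = t then A.val e.1.1 e.1.2 else 0
  have heval : ∀ (C : ValuedStructure σ) (g : A.Dom → C.Dom) (q : List C.Dom) (e : E),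
      evalPath C (p.map g ++ q) (⟨e.1.1, l e⟩ : PathType σ k) = C.val e.1.1 (g ∘ e.1.2) := by
    intro C g q e
    unfold evalPath
    congr 1
    funext i
    have h1 := hl e i
    have hlt : (l e i : ℕ) < p.length := (List.getElem?_eq_some_iff.1 h1).1
    show (p.map g ++ q).getD (l e i) _ = g (e.1.2 i)
    rw [List.getD_eq_getElem?_getD, List.getElem?_append_left (by simpa using hlt),
      List.getElem?_map, h1]
    rfl
  have hval : ∀ (C : ValuedStructure σ) (g : A.Dom → C.Dom),
      tupleVal C E g = (NTree.chain w n).val fun q => evalPath C (p.map g ++ q) := by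
    intro C g
    rw [NTree.val_chain (κ := fun t => evalPath C (p.map g ++ []) t)]
    · simp only [w, Finset.sum_mul, ite_mul, zero_mul]
      rw [Finset.sum_comm, tupleVal, ← Finset.sum_coe_sort]
      refine Finset.sum_congr rfl fun e _ => ?_
      rw [Finset.sum_ite_eq, if_pos (Finset.mem_univ _), heval]
    · intro q t ht
      obtain ⟨e, _, he⟩ := Finset.exists_ne_zero_of_sum_ne_zero ht
      split_ifs at he with h1
      · subst h1
        rw [heval, heval]
      · exact absurd rfl he
  refine ⟨NTree.chain w n, fun C g => ⟨fun h hh => ?_, g, fun _ _ => rfl, hval C g⟩⟩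
  rw [show h = g from funext fun v => hh v (Set.notMem_empty v)]
  exact (hval C g).le

theorem tupleVal_congr {C : ValuedStructure σ}
    {E : Finset (Σ f : σ.Symb, (Fin (σ.arity f) → A.Dom))} {h h' : A.Dom → C.Dom}
    (hh : ∀ e ∈ E, ∀ i, h (e.2 i) = h' (e.2 i)) : tupleVal C E h = tupleVal C E h' := by
  refine Finset.sum_congr rfl fun e he => ?_
  rw [show h ∘ e.2 = h' ∘ e.2 from funext fun i => hh e he i]

theorem Represents.vertex {p : List A.Dom} {S : Set A.Dom} {v : A.Dom} (hv : v ∈ S)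
    (hp : ∀ u ∈ p, u ∉ S) {E : Finset (Σ f : σ.Symb, (Fin (σ.arity f) → A.Dom))}
    {T : NTree (PathType σ k) n} (hT : Represents A (p ++ [v]) (S \ {v}) E T) :
    Represents A p S E (NTree.node Unit fun _ => T) := by
  classical
  intro C g
  have hval : (NTree.node Unit fun _ => T).val (fun q => evalPath C (p.map g ++ q)) =
      Finset.univ.sup fun a => T.val fun q =>
        evalPath C ((p ++ [v]).map (Function.update g v a) ++ q) := by
    refine (Fintype.sum_unique (ι := Unit) _).trans ?_
    congr 1
    funext a
    congr 1
    funext q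
    have h1 : p.map (Function.update g v a) = p.map g := List.map_congr_left fun u hu =>
      Function.update_of_ne (fun h : u = v => hp u hu (h ▸ hv)) _ _
    rw [List.map_append, h1]
    simp
  rw [hval]
  constructor
  · intro h hh
    refine le_trans ?_ (Finset.le_sup (f := fun a => T.val fun q =>
        evalPath C ((p ++ [v]).map (Function.update g v a) ++ q)) (Finset.mem_univ (h v)))
    refine (hT C (Function.update g v (h v))).1 h fun u hu => ?_
    by_cases huv : u = v
    · rw [huv, Function.update_self]
    · rw [Function.update_of_ne huv]
      exact hh u fun h => hu ⟨h, huv⟩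
  · obtain ⟨a, _, ha⟩ := Finset.exists_mem_eq_sup Finset.univ Finset.univ_nonempty fun a =>
      T.val fun q => evalPath C ((p ++ [v]).map (Function.update g v a) ++ q)
    obtain ⟨h, hh, hval'⟩ := (hT C (Function.update g v a)).2
    refine ⟨h, fun u hu => ?_, hval'.trans ha.symm⟩
    rw [hh u fun h => hu h.1, Function.update_of_ne]
    rintro rfl
    exact hu hv

theorem Represents.union {p : List A.Dom} {S₁ S₂ : Set A.Dom} (hd : Disjoint S₁ S₂)
    (hp : ∀ u ∈ p, u ∉ S₁ ∪ S₂) {E₁ E₂ : Finset (Σ f : σ.Symb, (Fin (σ.arity f) → A.Dom))}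
    (hE : Disjoint E₁ E₂) (hE₁ : ∀ e ∈ E₁, ∀ i, e.2 i ∈ S₁ ∨ e.2 i ∈ p)
    (hE₂ : ∀ e ∈ E₂, ∀ i, e.2 i ∈ S₂ ∨ e.2 i ∈ p) {I₁ I₂ : Type} [Fintype I₁] [Fintype I₂]
    {c₁ : I₁ → NTree (PathType σ k) n} {c₂ : I₂ → NTree (PathType σ k) n}
    (h₁ : Represents A p S₁ E₁ (.node I₁ c₁)) (h₂ : Represents A p S₂ E₂ (.node I₂ c₂)) :
    Represents A p (S₁ ∪ S₂) (E₁.disjUnion E₂ hE) (.node (I₁ ⊕ I₂) (Sum.elim c₁ c₂)) := by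
  classical
  intro C g
  have hval : ∀ φ : List C.Dom → PathType σ k → ℚ≥0,
      (NTree.node (I₁ ⊕ I₂) (Sum.elim c₁ c₂)).val φ =
        (NTree.node I₁ c₁).val φ + (NTree.node I₂ c₂).val φ :=
    fun φ => Fintype.sum_sum_type _
  have hsum : ∀ h : A.Dom → C.Dom, tupleVal C (E₁.disjUnion E₂ hE) h =
      tupleVal C E₁ h + tupleVal C E₂ h := fun h => Finset.sum_disjUnion hE
  rw [hval]
  constructor
  · intro h hh
    rw [hsum]
    refine add_le_add ?_ ?_
    · rw [tupleVal_congr (h' := fun v => if v ∈ S₁ then h v else g v)]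
      · exact (h₁ C g).1 _ fun v hv => if_neg hv
      · intro e he i
        rcases hE₁ e he i with h3 | h3
        · rw [if_pos h3]
        · rw [if_neg fun h4 => hp _ h3 (.inl h4)]
          exact hh _ (hp _ h3)
    · rw [tupleVal_congr (h' := fun v => if v ∈ S₂ then h v else g v)]
      · exact (h₂ C g).1 _ fun v hv => if_neg hv
      · intro e he i
        rcases hE₂ e he i with h3 | h3
        · rw [if_pos h3]
        · rw [if_neg fun h4 => hp _ h3 (.inr h4)]
          exact hh _ (hp _ h3)
  · obtain ⟨f₁, hf₁, hv₁⟩ := (h₁ C g).2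
    obtain ⟨f₂, hf₂, hv₂⟩ := (h₂ C g).2
    refine ⟨fun v => if v ∈ S₁ then f₁ v else f₂ v, fun v hv => ?_, ?_⟩
    · beta_reduce
      rw [if_neg fun h => hv (.inl h)]
      exact hf₂ v fun h => hv (.inr h)
    · rw [hsum, ← hv₁, ← hv₂]
      congr 1
      · refine tupleVal_congr fun e he i => ?_
        split_ifs with h3
        · rfl
        · have hip := (hE₁ e he i).resolve_left h3
          rw [hf₁ _ h3, hf₂ _ fun h => hp _ hip (.inr h)]
      · refine tupleVal_congr fun e he i => ?_
        split_ifs with h3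
        · have h4 : e.2 i ∉ S₂ := Set.disjoint_left.1 hd h3
          exact absurd (Or.inl h3) (hp _ ((hE₂ e he i).resolve_left h4))
        · rfl

/-- An elimination of the Gaifman graph arranges the vertices in a forest such that all tuples of
positive value lie on its paths. -/
theorem Elim.exists_represents {S : Set A.Dom} (h : Elim (gaifman A) n S) (p : List A.Dom)
    (hpk : p.length + n = k) (hp : ∀ v ∈ p, v ∉ S)
    (E : Finset (Σ f : σ.Symb, (Fin (σ.arity f) → A.Dom)))
    (hE : ∀ e ∈ E, 0 < A.val e.1 e.2) (hES : ∀ e ∈ E, ∀ i, e.2 i ∈ S ∨ e.2 i ∈ p) :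
    ∃ T : NTree (PathType σ k) n, Represents A p S E T := by
  classical
  induction h generalizing p E with
  | empty n =>
    exact exists_represents_empty p (by omega) E (fun e he i => (hES e he i).resolve_left id) n
  | @vertex n S v hv _ ih =>
    obtain ⟨T, hT⟩ := ih (p ++ [v])
      (by rw [List.length_append, List.length_singleton, Nat.add_assoc, Nat.add_comm 1 n]
          exact hpk)
      (fun u hu hu' => by
        rcases List.mem_append.1 hu with hu | hu
        · exact hp u hu hu'.1
        · exact hu'.2 (List.mem_singleton.1 hu)) E hE
      (fun e he i => by
        rcases hES e he i with h1 | h1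
        · by_cases h2 : e.2 i = v
          · exact .inr (by simp [h2])
          · exact .inl ⟨h1, h2⟩
        · exact .inr (by simp [h1]))
    exact ⟨_, hT.vertex hv hp⟩
  | @union n S₁ S₂ hS₁ hS₂ hd he ih1 ih2 =>
    rcases n with _ | n
    -- At height `0` a forest is a single leaf, and there are no subtrees to combine.
    · refine (elim_zero hS₁).symm ▸ (elim_zero hS₂).symm ▸ ?_
      rw [Set.union_empty]
      refine exists_represents_empty p (by omega) E (fun e he' i => ?_) 0
      refine (hES e he' i).resolve_left fun h => ?_
      rwa [elim_zero hS₁, elim_zero hS₂, Set.union_empty] at h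
    let E₁ := E.filter fun e => ∀ i, e.2 i ∈ S₁ ∨ e.2 i ∈ p
    let E₂ := E.filter fun e => ¬ ∀ i, e.2 i ∈ S₁ ∨ e.2 i ∈ p
    have hE₁ : ∀ e ∈ E₁, ∀ i, e.2 i ∈ S₁ ∨ e.2 i ∈ p := fun e he => (Finset.mem_filter.1 he).2
    have hE₂ : ∀ e ∈ E₂, ∀ i, e.2 i ∈ S₂ ∨ e.2 i ∈ p := by
      intro e heE i
      obtain ⟨heE, hne⟩ := Finset.mem_filter.1 heE
      push Not at hne
      obtain ⟨j, hj, hjp⟩ := hne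
      have hj2 : e.2 j ∈ S₂ := ((hES e heE j).resolve_right hjp).resolve_left hj
      rcases hES e heE i with (h1 | h1) | h1
      · refine absurd ?_ (he _ h1 _ hj2)
        exact ⟨fun h => hj (h ▸ h1), e.1, e.2, hE e heE, ⟨i, rfl⟩, ⟨j, rfl⟩⟩
      · exact .inl h1
      · exact .inr h1
    have hdE : Disjoint E₁ E₂ := Finset.disjoint_filter_filter_not E E _
    have hEu : E₁.disjUnion E₂ hdE = E := by
      rw [Finset.disjUnion_eq_union]
      exact Finset.filter_union_filter_not_eq _ E
    obtain ⟨T₁, hT₁⟩ := ih1 p hpk (fun v hv h => hp v hv (.inl h)) E₁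
      (fun e he => hE e (Finset.mem_filter.1 he).1) hE₁
    obtain ⟨T₂, hT₂⟩ := ih2 p hpk (fun v hv h => hp v hv (.inr h)) E₂
      (fun e he => hE e (Finset.mem_filter.1 he).1) hE₂
    cases T₁ with
    | node I₁ c₁ =>
      cases T₂ with
      | node I₂ c₂ =>
        have := Represents.union hd hp hdE hE₁ hE₂ hT₁ hT₂
        rw [hEu] at this
        exact ⟨_, this⟩

/-- The opt-value of a structure of treedepth at most `k` is the value of a forest of height `k`,
with one weight for every symbol and every way of placing its entries on a path. -/
theorem exists_opt_eq_val {A : ValuedStructure σ} (h : Elim (gaifman A) k Set.univ) :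
    ∃ T : NTree (PathType σ k) k, ∀ C, opt A C = T.val (evalPath C) := by
  classical
  let E : Finset (Σ f : σ.Symb, (Fin (σ.arity f) → A.Dom)) :=
    Finset.univ.filter fun e => 0 < A.val e.1 e.2
  obtain ⟨T, hT⟩ := h.exists_represents (k := k) [] (Nat.zero_add k) (by simp) E
    (fun e he => (Finset.mem_filter.1 he).2) fun e he i => .inl trivial
  have hval : ∀ (C : ValuedStructure σ) (h : A.Dom → C.Dom), mapVal A C h = tupleVal C E h := by
    intro C h
    unfold mapVal tupleVal
    rw [Finset.sum_filter, Fintype.sum_sigma]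
    refine Finset.sum_congr rfl fun f _ => Finset.sum_congr rfl fun x _ => ?_
    split_ifs with h1
    · rfl
    · rw [not_lt, nonpos_iff_eq_zero] at h1
      rw [h1, zero_mul]
  refine ⟨T, fun C => le_antisymm ?_ ?_⟩
  · obtain ⟨h, hh⟩ := exists_mapVal_eq_opt A C
    rw [← hh, hval]
    exact (hT C h).1 h fun _ _ => rfl
  · obtain ⟨h, _, hh⟩ := (hT C fun _ => Classical.arbitrary C.Dom).2
    refine le_trans (le_of_eq ?_) (mapVal_le_opt h)
    rw [hval]
    exact hh.symm

end OfElim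

/-! ### Bounded signatures -/

section BoundedSignatures

theorem card_pathType_le {σ : Signature} {N k : ℕ} (h1 : Fintype.card σ.Symb ≤ N)
    (h2 : ∀ f, σ.arity f ≤ N) : Fintype.card (PathType σ k) ≤ N * (k + 1) ^ N := by
  rw [Fintype.card_sigma]
  calc ∑ f : σ.Symb, Fintype.card (Fin (σ.arity f) → Fin k)
      ≤ ∑ _f : σ.Symb, (k + 1) ^ N := by
        refine Finset.sum_le_sum fun f _ => ?_
        rw [Fintype.card_fun, Fintype.card_fin, Fintype.card_fin]
        exact (Nat.pow_le_pow_left (Nat.le_succ k) _).trans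
          (Nat.pow_le_pow_right (Nat.succ_pos k) (h2 f))
    _ = Fintype.card σ.Symb * (k + 1) ^ N := by
        rw [Finset.sum_const, Finset.card_univ, smul_eq_mul]
    _ ≤ N * (k + 1) ^ N := Nat.mul_le_mul_right _ h1

theorem exists_size_optDist_le (N k : ℕ) (ε : ℝ) (hε : 0 < ε) :
    ∃ d : ℕ, ∀ σ : Signature, Fintype.card σ.Symb ≤ N → (∀ f, σ.arity f ≤ N) →
      ∀ A : ValuedStructure σ, treedepth A.Dom (gaifman A) ≤ k →
        ∃ B : ValuedStructure σ, size B.Dom (gaifman B) ≤ d ∧ optDist A B ≤ ENNReal.ofReal ε := by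
  obtain ⟨δ, hδ0, hδ2, hδε⟩ := exists_pos_rat_two_mul_le hε
  lift δ to ℚ≥0 using hδ0.le
  choose K hK using fun m => NTree.exists_val_close_card_le m k δ (by exact_mod_cast hδ0)
  refine ⟨(Finset.range (N * (k + 1) ^ N + 1)).sup K + 1, fun σ h1 h2 A hA => ?_⟩
  obtain ⟨T, hT⟩ := exists_opt_eq_val (treedepth_le_iff_elim.1 hA)
  obtain ⟨T', hcard, hT'⟩ := hK _ (PathType σ k) rfl T
  refine ⟨T'.toStructure, ?_, (optDist_le hδ0.le hδ2 (fun C => ?_) fun C => ?_).trans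
    (ENNReal.ofReal_le_ofReal hδε)⟩
  · have h3 : size T'.toStructure.Dom (gaifman T'.toStructure) = Nat.card T'.Vert + 1 := by
      rw [Nat.card_eq_fintype_card]
      exact Fintype.card_option
    rw [h3]
    have h4 := Finset.le_sup (f := K) (Finset.mem_range.2
      (Nat.lt_add_one_of_le (card_pathType_le (k := k) h1 h2)))
    exact Nat.add_le_add_right (hcard.trans h4) 1
  · have h3 := (hT' C.Dom (evalPath C)).1
    rw [← hT, ← NTree.opt_toStructure] at h3
    have h4 : (opt A C : ℚ) ≤ opt T'.toStructure C + δ * opt A C := by exact_mod_cast h3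
    linarith
  · have h3 := (hT' C.Dom (evalPath C)).2
    rw [← hT, ← NTree.opt_toStructure] at h3
    have h4 : (opt T'.toStructure C : ℚ) ≤ opt A C + δ * opt A C := by exact_mod_cast h3
    linarith

theorem IsPliable.size_of_treedepth {𝒜 : StructureClass} (h : IsPliable treedepth 𝒜)
    (h𝒜 : HasBoundedSignatures 𝒜) : IsPliable size 𝒜 := by
  obtain ⟨N, hN⟩ := h𝒜
  refine h.of_exists_optDist_le fun k ε hε => ?_
  obtain ⟨d, hd⟩ := exists_size_optDist_le N k ε hε
  exact ⟨d, fun σ hσ => hd σ (hN σ hσ).1 (hN σ hσ).2⟩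

end BoundedSignatures

end Pliability

theorem mainTheorem5 (𝒜 : Pliability.StructureClass) :
    List.TFAE
      [Pliability.IsPliable Pliability.treedepth 𝒜,
       Pliability.IsPliable Pliability.treewidth 𝒜,
       Pliability.IsPliable Pliability.hadwiger 𝒜] ∧
    (Pliability.HasBoundedSignatures 𝒜 →
      List.TFAE
        [Pliability.IsPliable Pliability.treedepth 𝒜,
         Pliability.IsPliable Pliability.treewidth 𝒜,
         Pliability.IsPliable Pliability.hadwiger 𝒜,
         Pliability.IsPliable Pliability.size 𝒜,
         Pliability.IsPliable Pliability.maxComponentSize 𝒜]) := by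
  have h12 (h : Pliability.IsPliable Pliability.treedepth 𝒜) :
      Pliability.IsPliable Pliability.treewidth 𝒜 :=
    h.of_le 0 fun _ _ _ => Pliability.treewidth_le_treedepth
  have h23 (h : Pliability.IsPliable Pliability.treewidth 𝒜) :
      Pliability.IsPliable Pliability.hadwiger 𝒜 :=
    h.of_le 1 fun _ _ _ => Pliability.hadwiger_le_treewidth
  have h31 (h : Pliability.IsPliable Pliability.hadwiger 𝒜) :
      Pliability.IsPliable Pliability.treedepth 𝒜 := h.treedepth_of_hadwiger
  refine ⟨?_, fun hb => ?_⟩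
  · tfae_have 1 → 2 := h12
    tfae_have 2 → 3 := h23
    tfae_have 3 → 1 := h31
    tfae_finish
  · tfae_have 1 → 2 := h12
    tfae_have 2 → 3 := h23
    tfae_have 3 → 1 := h31
    tfae_have 1 → 4 := fun h => h.size_of_treedepth hb
    tfae_have 4 → 5 := fun h => h.of_le 0 fun _ _ _ => Pliability.maxComponentSize_le_size
    tfae_have 5 → 1 := fun h => h.of_le 0 fun _ _ _ => Pliability.treedepth_le_maxComponentSize
    tfae_finish
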